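/- Let $\sigma_0,L_0,\delta_0>0$. For $k>0$ put $\alpha=ik$, $\sigma=\sigma_0k$, $L=L_0/k$, $\delta=\delta_0/k$, and consider $$\mathcal Lu:=-u''+(ik\sigma-k^2)u,\qquad \mathcal B_lu:=-u'+\alpha u,\qquad \mathcal B_ru:=u'+\alpha u .$$ For $N\ge 2$ and $a_1\in\mathbb R$ let $a_j=a_1+(j-1)L$ and $b_j=a_j+L+2\delta$, so that the subdomains $\Omega_j=(a_j,b_j)$, $1\le j\le N$, of $\Omega=(a_1,b_N)$ have length $L+2\delta$ and consecutive ones overlap by $2\delta$. Let $u$ be the solution of $\mathcal Lu=0$ in $\Omega$, $\mathcal B_lu(a_1)=g_1$, $\mathcal B_ru(b_N)=g_2$. The parallel Schwarz method computes, from arbitrary $C^1$ initial guesses $u_j^0$ on $\overline{\Omega_j}$, the solutions $u_j^n$ of $$\mathcal Lu_j^n=0\ \text{in }\Omega_j,\qquad \mathcal B_lu_j^n(a_j)=\mathcal B_lu_{j-1}^{n-1}(a_j),\qquad \mathcal B_ru_j^n(b_j)=\mathcal B_ru_{j+1}^{n-1}(b_j),$$ where for $j=1$ the left datum is replaced by $g_1$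 and for $j=N$ the right datum by $g_2$. (Solutions are classical, $C^2$ up to the boundary.) With $e_j^n=u-u_j^n$, let $$\mathcal R^n=\big[\mathcal R^n_+(b_1),\mathcal R^n_-(a_2),\mathcal R^n_+(b_2),\dots,\mathcal R^n_+(b_{N-1}),\mathcal R^n_-(a_N)\big]^T,\qquad \mathcal R^n_-(a_j)=\mathcal B_le^n_{j-1}(a_j),\quad \mathcal R^n_+(b_j)=\mathcal B_re^n_{j+1}(b_j).$$ With $\zeta=\sqrt{ik\sigma-k^2}$ (principal branch) and $D=(\zeta+\alpha)^2e^{\zeta(2\delta+L)}-(\zeta-\alpha)^2e^{-\zeta(2\delta+L)}$, let $$a=\frac{(\zeta+\alpha)^2e^{2\zeta\delta}-(\zeta-\alpha)^2e^{-2\zeta\delta}}{D},\qquad b=-\frac{(\zeta^2-\alpha^2)(e^{\zeta L}-e^{-\zeta L})}{D},$$ and let $\mathcal T_{1d}=\mathcal T_{1d}(k,N)\in\mathbb C^{2(N-1)\times2(N-1)}$ be the block tridiagonal Toeplitz matrix with diagonal blocks $\begin{bmatrix}0&b\\b&0\end{bmatrix}$, superdiagonal blocks $\begin{bmatrix}a&0\\0&0\end{bmatrix}$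 and subdiagonal blocks $\begin{bmatrix}0&0\\0&a\end{bmatrix}$. Then: 1. For every $k>0$ the boundary value problems of the method are well posed: for all $p<q$ and all data $g_l,g_r\in\mathbb C$ there is exactly one solution on $[p,q]$ of $\mathcal Lv=0$ in $(p,q)$, $\mathcal B_lv(p)=g_l$, $\mathcal B_rv(q)=g_r$. 2. $\mathcal T_{1d}$ is the iteration matrix of the method: $\mathcal R^{n+1}=\mathcal T_{1d}\,\mathcal R^{n}$ for all $k>0$, $N\ge2$, $a_1$, $g_1,g_2$, all initial guesses and all $n\ge0$. 3. The coefficients $a$ and $b$, and hence the iteration matrix $\mathcal T_{1d}(k,N)$ for each $N$, do not depend on $k$. 4. The convergence factor $R_{1d}=\lim_{N\to\infty}\rho(\mathcal T_{1d}(k,N))$ exists for every $k>0$, does not depend on $k$, and satisfies $R_{1d}<1$. 5. The convergence is robust in $k$ and ultimately independent of the number of subdomains: for every $\varepsilon>0$ there are $n_0$ and $N_0$, depending only on $\varepsilon,\sigma_0,L_0,\delta_0$, such that for all $N\ge N_0$, all $k>0$, all $a_1,g_1,g_2$, all initial guesses and all $n\ge n_0$ one has $\|\mathcal R^n\|_2\le\varepsilon\,\|\mathcal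 R^0\|_2$ (Euclidean norm). -/

import Mathlib

open Filter Topology
open scoped ENNReal

noncomputable section

namespace Schwarz1D

/-- The parameters of the one-dimensional problem and of its decomposition: wave number `k`,
(rescaled) conductivity `σ`, impedance parameter `α`, distance `L` between the left ends of
consecutive subdomains, half overlap `δ`. -/
structure Params where
  k : ℝ
  σ : ℝ
  α : ℂ
  L : ℝ
  δ : ℝ

/-- The scaled family with classical impedance conditions:
`α = i k`, `σ = σ₀ k`, `L = L₀ / k`, `δ = δ₀ / k`. -/
def scaledParams (σ₀ L₀ δ₀ k : ℝ) : Params where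
  k := k
  σ := σ₀ * k
  α := Complex.I * (k : ℂ)
  L := L₀ * k⁻¹
  δ := δ₀ * k⁻¹

/-- The differential operator `ℒ u = -u'' + (i k σ - k²) u`, with derivatives taken within `s`. -/
def opL (P : Params) (s : Set ℝ) (u : ℝ → ℂ) (x : ℝ) : ℂ :=
  -iteratedDerivWithin 2 u s x
    + (Complex.I * (P.k : ℂ) * (P.σ : ℂ) - (P.k : ℂ) ^ 2) * u x

/-- The left Robin operator `ℬ_l u = -u' + α u`. -/
def opBl (P : Params) (s : Set ℝ) (u : ℝ → ℂ) (x : ℝ) : ℂ :=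
  -derivWithin u s x + P.α * u x

/-- The right Robin operator `ℬ_r u = u' + α u`. -/
def opBr (P : Params) (s : Set ℝ) (u : ℝ → ℂ) (x : ℝ) : ℂ :=
  derivWithin u s x + P.α * u x

/-- `u` is a classical solution, `C²` up to the boundary, of `ℒ u = 0` in `(p, q)`,
`ℬ_l u (p) = gl`, `ℬ_r u (q) = gr`. Only the values of `u` on `[p, q]` matter. -/
structure SolvesBVP (P : Params) (p q : ℝ) (gl gr : ℂ) (u : ℝ → ℂ) : Prop where
  contDiffOn : ContDiffOn ℝ 2 u (Set.Icc p q)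
  eqn : ∀ x ∈ Set.Ioo p q, opL P (Set.Icc p q) u x = 0
  left : opBl P (Set.Icc p q) u p = gl
  right : opBr P (Set.Icc p q) u q = gr

/-- The left end `a_j = a_1 + (j - 1) L` of the `j`-th subdomain, where `a_1 = x₀`. -/
def aPt (P : Params) (x₀ : ℝ) (j : ℕ) : ℝ := x₀ + ((j : ℝ) - 1) * P.L

/-- The right end `b_j = a_j + L + 2 δ` of the `j`-th subdomain. -/
def bPt (P : Params) (x₀ : ℝ) (j : ℕ) : ℝ := aPt P x₀ j + P.L + 2 * P.δ

/-- The closure `[a_j, b_j]` of the `j`-th subdomain. -/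
def dom (P : Params) (x₀ : ℝ) (j : ℕ) : Set ℝ := Set.Icc (aPt P x₀ j) (bPt P x₀ j)

/-- A run of the parallel Schwarz method with `N` subdomains on `(a_1, b_N)`, `a_1 = x₀`:
`u` is the solution of the global problem with boundary data `g₁`, `g₂`, and `w n j` is the
`n`-th iterate on the `j`-th subdomain, `1 ≤ j ≤ N`. The initial guess is any `C¹` function. -/
structure IsSchwarzRun (P : Params) (N : ℕ) (x₀ : ℝ) (g₁ g₂ : ℂ)
    (u : ℝ → ℂ) (w : ℕ → ℕ → ℝ → ℂ) : Prop where
  exact_sol : SolvesBVP P (aPt P x₀ 1) (bPt P x₀ N) g₁ g₂ u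
  init : ∀ j, 1 ≤ j → j ≤ N → ContDiffOn ℝ 1 (w 0 j) (dom P x₀ j)
  step : ∀ n j, 1 ≤ j → j ≤ N →
    SolvesBVP P (aPt P x₀ j) (bPt P x₀ j)
      (if j = 1 then g₁ else opBl P (dom P x₀ (j - 1)) (w n (j - 1)) (aPt P x₀ j))
      (if j = N then g₂ else opBr P (dom P x₀ (j + 1)) (w n (j + 1)) (bPt P x₀ j))
      (w (n + 1) j)

/-- The Robin interface data of the errors `e_j = u - w_j`,
`(ℛ₊(b_1), ℛ₋(a_2), ℛ₊(b_2), ℛ₋(a_3), …, ℛ₊(b_{N-1}), ℛ₋(a_N))`, in `N - 1` blocks of size two,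
where `ℛ₊(b_j) = ℬ_r e_{j+1} (b_j)` and `ℛ₋(a_j) = ℬ_l e_{j-1} (a_j)`.
The block with index `i` is `(ℛ₊(b_{i+1}), ℛ₋(a_{i+2}))`. -/
def interfaceData (P : Params) (N : ℕ) (x₀ : ℝ) (u : ℝ → ℂ) (w : ℕ → ℝ → ℂ) :
    Fin (N - 1) × Fin 2 → ℂ :=
  fun p =>
    if p.2 = 0 then
      opBr P (dom P x₀ ((p.1 : ℕ) + 2)) (fun x => u x - w ((p.1 : ℕ) + 2) x) (bPt P x₀ ((p.1 : ℕ) + 1))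
    else
      opBl P (dom P x₀ ((p.1 : ℕ) + 1)) (fun x => u x - w ((p.1 : ℕ) + 1) x) (aPt P x₀ ((p.1 : ℕ) + 2))

/-- The Euclidean norm of the interface data. -/
def euclNorm {ι : Type*} [Fintype ι] (r : ι → ℂ) : ℝ := ‖WithLp.toLp 2 r‖

/-- `ζ = √(i k σ - k²)`, the principal branch. -/
def zeta (P : Params) : ℂ :=
  (Complex.I * (P.k : ℂ) * (P.σ : ℂ) - (P.k : ℂ) ^ 2) ^ (1 / 2 : ℂ)

/-- The common denominator of the coefficients of the iteration matrix. -/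
def coeffD (P : Params) : ℂ :=
  (zeta P + P.α) ^ 2 * Complex.exp (zeta P * (2 * P.δ + P.L))
    - (zeta P - P.α) ^ 2 * Complex.exp (-(zeta P * (2 * P.δ + P.L)))

/-- The coefficient `a` of the iteration matrix. -/
def coeffA (P : Params) : ℂ :=
  ((zeta P + P.α) ^ 2 * Complex.exp (2 * zeta P * P.δ)
    - (zeta P - P.α) ^ 2 * Complex.exp (-(2 * zeta P * P.δ))) / coeffD P

/-- The coefficient `b` of the iteration matrix. -/
def coeffB (P : Params) : ℂ :=
  -((zeta P ^ 2 - P.α ^ 2) * (Complex.exp (zeta P * P.L) - Complex.exp (-(zeta P * P.L))))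
    / coeffD P

/-- The `2m × 2m` block tridiagonal Toeplitz matrix with diagonal blocks `[0, b; b, 0]`,
superdiagonal blocks `[a, 0; 0, 0]` and subdiagonal blocks `[0, 0; 0, a]`. -/
def blockToeplitz (m : ℕ) (a b : ℂ) : Matrix (Fin m × Fin 2) (Fin m × Fin 2) ℂ :=
  Matrix.of fun p q =>
    if (p.1 : ℕ) = q.1 then !![0, b; b, 0] p.2 q.2
    else if (p.1 : ℕ) + 1 = q.1 then !![a, 0; 0, 0] p.2 q.2
    else if (q.1 : ℕ) + 1 = p.1 then !![0, 0; 0, a] p.2 q.2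
    else 0

/-- The iteration matrix for `N` subdomains. -/
def iterMatrix (P : Params) (N : ℕ) : Matrix (Fin (N - 1) × Fin 2) (Fin (N - 1) × Fin 2) ℂ :=
  blockToeplitz (N - 1) (coeffA P) (coeffB P)

end Schwarz1D

end

namespace Schwarz1D

/-! Both the spectral radius limit and the norm bound are governed by `max ‖a + b‖ ‖a - b‖`. After a
shift of the row pairing the iteration matrix acts by copies of `[a, b; b, a]` and two truncated end
blocks, so this maximum bounds the Euclidean operator norm for every size
(`euclNorm_blockToeplitz_mulVec_le`). It is also attained in the limit: sine eigenvectors reduce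
part of the spectrum to a scalar equation, and the implicit function theorem supplies eigenvalues
tending to `a + b` and to `a - b` (`tendsto_spectralRadius_blockToeplitz`).

The maximum is below one because `a - ε b`, `ε = ±1`, is a quotient of one function at `δ - L/2` and
at `δ + L/2` (`coeffA_sub_mul_coeffB`). The squared modulus of this function increases on `s ≥ 0`
and is no larger at `-s` than at `s` (`energy_lt_energy`); positivity of `L` and `δ` gives `|δ -
L/2| < δ + L/2`. The same monotonicity makes the Robin determinant nonzero, hence gives
well-posedness.

Independence of `k` is homogeneity: `ζ` and `α` scale like `k`, lengths like `k⁻¹`. The matrix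
arises by solving the equation with exponentials and reading off Robin traces
(`interfaceData_succ`). -/

/-! ### Action and Euclidean norm of the block Toeplitz matrix. -/

theorem blockToeplitz_mulVec_zero (m : ℕ) (a b : ℂ) (r : Fin m × Fin 2 → ℂ) (i : Fin m) :
    (blockToeplitz m a b).mulVec r (i, 0) =
      b * r (i, 1) + a * (if h : (i : ℕ) + 1 < m then r (⟨i + 1, h⟩, 0) else 0) := by
  have key : ∀ j : Fin m, (∑ s : Fin 2, blockToeplitz m a b (i, 0) (j, s) * r (j, s)) =
      (if j = i then b * r (i, 1) else 0) +
        (if (j : ℕ) = i + 1 then a * r (j, 0) else 0) := by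
    intro j
    rw [Fin.sum_univ_two]
    simp only [blockToeplitz, Matrix.of_apply]
    rcases eq_or_ne j i with rfl | hji
    · simp
    · have hv : (j : ℕ) ≠ i := fun h => hji (Fin.ext h)
      by_cases h1 : (j : ℕ) = i + 1
      · simp [h1, hji]
      · have h1' : ¬ ((i : ℕ) + 1 = j) := fun h => h1 h.symm
        by_cases h2 : (j : ℕ) + 1 = i <;> simp [hv.symm, hji, h1, h1', h2]
  rw [Matrix.mulVec, dotProduct, Fintype.sum_prod_type]
  simp only [key, Finset.sum_add_distrib, Finset.sum_ite_eq', Finset.mem_univ, if_true]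
  congr 1
  split_ifs with h
  · rw [Finset.sum_eq_single (⟨i + 1, h⟩ : Fin m)]
    · simp
    · intro j _ hj
      rw [if_neg fun h' => hj (Fin.ext h')]
    · simp
  · rw [Finset.sum_eq_zero, mul_zero]
    intro j _
    rw [if_neg]
    have := j.2
    omega

theorem blockToeplitz_mulVec_one (m : ℕ) (a b : ℂ) (r : Fin m × Fin 2 → ℂ) (i : Fin m) :
    (blockToeplitz m a b).mulVec r (i, 1) =
      b * r (i, 0) + a * (if 0 < (i : ℕ) then r (⟨i - 1, by omega⟩, 1) else 0) := by
  have key : ∀ j : Fin m, (∑ s : Fin 2, blockToeplitz m a b (i, 1) (j, s) * r (j, s)) =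
      (if j = i then b * r (i, 0) else 0) +
        (if (j : ℕ) + 1 = i then a * r (j, 1) else 0) := by
    intro j
    rw [Fin.sum_univ_two]
    simp only [blockToeplitz, Matrix.of_apply]
    rcases eq_or_ne j i with rfl | hji
    · simp
    · have hv : (j : ℕ) ≠ i := fun h => hji (Fin.ext h)
      by_cases h1 : (i : ℕ) + 1 = j
      · have h2 : ¬ ((j : ℕ) + 1 = i) := by omega
        simp [hv.symm, hji, h1, h2]
      · by_cases h2 : (j : ℕ) + 1 = i <;> simp [hv.symm, hji, h1, h2]
  rw [Matrix.mulVec, dotProduct, Fintype.sum_prod_type]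
  simp only [key, Finset.sum_add_distrib, Finset.sum_ite_eq', Finset.mem_univ, if_true]
  congr 1
  split_ifs with h
  · rw [Finset.sum_eq_single (⟨i - 1, by omega⟩ : Fin m)]
    · rw [if_pos (show (i : ℕ) - 1 + 1 = i by omega)]
    · intro j _ hj
      rw [if_neg fun h' => hj (Fin.ext (show (j : ℕ) = i - 1 by omega))]
    · simp
  · rw [Finset.sum_eq_zero, mul_zero]
    intro j _
    rw [if_neg]
    omega

/-- The norm of the normal matrix `[a, b; b, a]` is the maximum of `‖a + b‖` and `‖a - b‖`. -/
theorem sq_norm_add_sq_norm_swap_le (a b x y : ℂ) :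
    ‖b * y + a * x‖ ^ 2 + ‖b * x + a * y‖ ^ 2 ≤
      max ‖a + b‖ ‖a - b‖ ^ 2 * (‖x‖ ^ 2 + ‖y‖ ^ 2) := by
  -- The sum and difference of the two components diagonalize the swap; the parallelogram law passes
  -- to these coordinates and back.
  have h1 := parallelogram_law_with_norm ℝ (b * y + a * x) (b * x + a * y)
  have h2 := parallelogram_law_with_norm ℝ x y
  have e1 : b * y + a * x + (b * x + a * y) = (a + b) * (x + y) := by ring
  have e2 : b * y + a * x - (b * x + a * y) = (a - b) * (x - y) := by ring
  rw [e1, e2, norm_mul, norm_mul] at h1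
  have h3 : ‖a + b‖ ^ 2 ≤ max ‖a + b‖ ‖a - b‖ ^ 2 := by gcongr; exact le_max_left _ _
  have h4 : ‖a - b‖ ^ 2 ≤ max ‖a + b‖ ‖a - b‖ ^ 2 := by gcongr; exact le_max_right _ _
  nlinarith [mul_le_mul_of_nonneg_right h3 (sq_nonneg ‖x + y‖),
    mul_le_mul_of_nonneg_right h4 (sq_nonneg ‖x - y‖)]

theorem euclNorm_sq {m : ℕ} (r : Fin m × Fin 2 → ℂ) :
    euclNorm r ^ 2 = ∑ i : Fin m, (‖r (i, 0)‖ ^ 2 + ‖r (i, 1)‖ ^ 2) := by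
  rw [euclNorm, EuclideanSpace.norm_sq_eq, Fintype.sum_prod_type]
  simp [Fin.sum_univ_two]

theorem euclNorm_nonneg {ι : Type*} [Fintype ι] (r : ι → ℂ) : 0 ≤ euclNorm r := norm_nonneg _

/-- Up to a permutation of the rows, `blockToeplitz m a b` is block diagonal with blocks
`[a, b; b, a]` and two scalar blocks `b`. -/
theorem euclNorm_blockToeplitz_mulVec_le (m : ℕ) (a b : ℂ) (r : Fin m × Fin 2 → ℂ) :
    euclNorm ((blockToeplitz m a b).mulVec r) ≤ max ‖a + b‖ ‖a - b‖ * euclNorm r := by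
  set R := max ‖a + b‖ ‖a - b‖ with hR
  have hR0 : 0 ≤ R := (norm_nonneg _).trans (le_max_left _ _)
  refine le_of_sq_le_sq ?_ (mul_nonneg hR0 (euclNorm_nonneg _))
  -- `Y` is shifted by one against `X`, so that rows `(i, 0)` and `(i + 1, 1)` together apply `[a,
  -- b; b, a]` to `(X (i + 1), Y (i + 1))`. Zero padding `Y 0 = X m = 0` encodes the missing
  -- neighbours at the ends.
  set X : ℕ → ℂ := fun i => if h : i < m then r (⟨i, h⟩, 0) else 0 with hX
  set Y : ℕ → ℂ := fun i => if h : 0 < i ∧ i - 1 < m then r (⟨i - 1, h.2⟩, 1) else 0 with hY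
  have hXi : ∀ i : Fin m, r (i, 0) = X i := fun i => by simp [hX]
  have hYi : ∀ i : Fin m, r (i, 1) = Y (i + 1) := fun i => by simp [hY]
  have hY0 : Y 0 = 0 := by simp [hY]
  have hXm : X m = 0 := by simp [hX]
  have e0 : ∀ i : Fin m, (blockToeplitz m a b).mulVec r (i, 0) = b * Y (i + 1) + a * X (i + 1) := by
    intro i
    rw [blockToeplitz_mulVec_zero, hYi]
  have e1 : ∀ i : Fin m, (blockToeplitz m a b).mulVec r (i, 1) = b * X i + a * Y i := by
    intro i
    rw [blockToeplitz_mulVec_one, hXi]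
    congr 2
    have : (i : ℕ) - 1 < m := by omega
    by_cases h : 0 < (i : ℕ) <;> simp [hY, this, h]
  rw [mul_pow, euclNorm_sq, euclNorm_sq]
  simp only [e0, e1, hXi, hYi]
  rw [Fin.sum_univ_eq_sum_range
      (fun i => ‖b * Y (i + 1) + a * X (i + 1)‖ ^ 2 + ‖b * X i + a * Y i‖ ^ 2),
    Fin.sum_univ_eq_sum_range (fun i => ‖X i‖ ^ 2 + ‖Y (i + 1)‖ ^ 2),
    Finset.sum_add_distrib, Finset.sum_add_distrib]
  have s1 := Finset.sum_range_succ' (fun i => ‖b * Y i + a * X i‖ ^ 2) m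
  have s2 := Finset.sum_range_succ (fun i => ‖b * X i + a * Y i‖ ^ 2) m
  have s3 := Finset.sum_range_succ (fun i => ‖X i‖ ^ 2) m
  have s4 := Finset.sum_range_succ' (fun i => ‖Y i‖ ^ 2) m
  -- Summing over `0, …, m` completes both end pairs. This adds two nonnegative terms on the left,
  -- discarded through `p1` and `p2`, and nothing on the right.
  have s5 : ∑ i ∈ Finset.range (m + 1), (‖b * Y i + a * X i‖ ^ 2 + ‖b * X i + a * Y i‖ ^ 2) ≤
      ∑ i ∈ Finset.range (m + 1), R ^ 2 * (‖X i‖ ^ 2 + ‖Y i‖ ^ 2) :=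
    Finset.sum_le_sum fun i _ => sq_norm_add_sq_norm_swap_le a b (X i) (Y i)
  rw [Finset.sum_add_distrib, ← Finset.mul_sum, Finset.sum_add_distrib, s3, s4] at s5
  simp only [hY0, hXm, norm_zero, ne_eq, OfNat.ofNat_ne_zero, not_false_eq_true, zero_pow,
    add_zero] at s5
  have p1 : 0 ≤ ‖b * Y 0 + a * X 0‖ ^ 2 := by positivity
  have p2 : 0 ≤ ‖b * X m + a * Y m‖ ^ 2 := by positivity
  linarith

theorem spectralRadius_blockToeplitz_le (m : ℕ) (a b : ℂ) :
    spectralRadius ℂ (blockToeplitz m a b) ≤ ENNReal.ofReal (max ‖a + b‖ ‖a - b‖) := by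
  refine iSup₂_le fun l hl => ?_
  rw [← Matrix.spectrum_toLin', ← Module.End.hasEigenvalue_iff_mem_spectrum] at hl
  obtain ⟨v, hv⟩ := hl.exists_hasEigenvector
  have h := hv.apply_eq_smul
  rw [Matrix.toLin'_apply] at h
  have h1 := euclNorm_blockToeplitz_mulVec_le m a b v
  rw [h, euclNorm, WithLp.toLp_smul, norm_smul] at h1
  have hpos : 0 < euclNorm v := by
    rw [euclNorm, norm_pos_iff]
    simpa using hv.2
  rw [← enorm_eq_nnnorm, ← ofReal_norm]
  exact ENNReal.ofReal_le_ofReal (le_of_mul_le_mul_right h1 hpos)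

/-! ### Eigenvalues and the limit of the spectral radius. -/

/-- With `A = m θ` and `B = (m - t) θ` this is the recurrence satisfied by the sine eigenvector; the
factor `sin (A + θ)` is where the root condition on `θ` enters. -/
theorem sin_mul_sin_eq (A B θ : ℂ) :
    Complex.sin A * Complex.sin B =
      Complex.sin θ * Complex.sin (A - B + θ) + Complex.sin (A + θ) * Complex.sin (B - θ) := by
  simp only [Complex.sin_add, Complex.sin_sub, Complex.cos_sub]
  linear_combination -(Complex.sin A * Complex.sin B) * Complex.sin_sq_add_cos_sq θ

theorem cos_natCast_mul_pi (l : ℕ) : Complex.cos (l * Real.pi) = (-1) ^ l := by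
  rw [← Complex.ofReal_natCast, ← Complex.ofReal_mul, ← Complex.ofReal_cos, Real.cos_nat_mul_pi]
  simp

theorem sin_natCast_mul_pi (l : ℕ) : Complex.sin (l * Real.pi) = 0 := by
  rw [← Complex.ofReal_natCast, ← Complex.ofReal_mul, ← Complex.ofReal_sin, Real.sin_nat_mul_pi]
  simp

/-- Eigenpairs of `blockToeplitz m a b` that are symmetric under reversal of the interfaces. -/
theorem mem_spectrum_blockToeplitz {m : ℕ} (hm : 0 < m) {a b θ : ℂ} (hθ : Complex.sin θ ≠ 0)
    (h : b * Complex.sin ((m + 1) * θ) = a * Complex.sin θ) :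
    b * Complex.sin (m * θ) / Complex.sin θ ∈ spectrum ℂ (blockToeplitz m a b) := by
  set lam := b * Complex.sin (m * θ) / Complex.sin θ with hlam
  set r : Fin m × Fin 2 → ℂ := fun p =>
    if p.2 = 0 then Complex.sin ((m - (p.1 : ℕ)) * θ) else Complex.sin (((p.1 : ℕ) + 1) * θ) with hr
  have key : ∀ t : ℂ, lam * Complex.sin ((m - t) * θ) =
      b * Complex.sin ((t + 1) * θ) + a * Complex.sin ((m - t - 1) * θ) := by
    intro t
    rw [hlam, div_mul_eq_mul_div, div_eq_iff hθ]
    have e := sin_mul_sin_eq (m * θ) ((m - t) * θ) θ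
    rw [show m * θ - (m - t) * θ + θ = (t + 1) * θ by ring,
      show m * θ + θ = (m + 1) * θ by ring,
      show (m - t) * θ - θ = (m - t - 1) * θ by ring] at e
    linear_combination b * e + Complex.sin ((m - t - 1) * θ) * h
  rw [← Matrix.spectrum_toLin', ← Module.End.hasEigenvalue_iff_mem_spectrum]
  refine Module.End.hasEigenvalue_of_hasEigenvector (x := r) ⟨?_, ?_⟩
  · rw [Module.End.mem_eigenspace_iff, Matrix.toLin'_apply]
    funext ⟨i, s⟩
    fin_cases s
    · simp only [Fin.zero_eta, Pi.smul_apply, smul_eq_mul, blockToeplitz_mulVec_zero, hr]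
      have e := key i
      simp
      rw [e]
      congr 1
      split_ifs with hi
      · rw [sub_sub]
      -- In the last block the neighbour term is `sin 0`, in agreement with the zero default.
      · have hi' : (m : ℂ) = i + 1 := by
          have := i.2
          exact_mod_cast (show m = i + 1 by omega)
        simp [hi']
    · simp only [Fin.mk_one, Pi.smul_apply, smul_eq_mul, blockToeplitz_mulVec_one, hr]
      -- By reversal symmetry the second row is the first one at the reflected index.
      have e := key (m - i - 1)
      rw [show (m : ℂ) - (m - i - 1) = i + 1 by ring, show (m : ℂ) - i - 1 + 1 = m - i by ring,
        add_sub_cancel_right] at e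
      simp
      rw [e]
      congr 1
      split_ifs with hi
      · rw [Nat.cast_sub (by omega), Nat.cast_one, sub_add_cancel]
      · simp [show (i : ℕ) = 0 by omega]
  · intro h0
    have := congrFun h0 (⟨0, hm⟩, 1)
    simp [hr] at this
    exact hθ this

/-- The equation for the eigenvalue parameter has roots near every multiple of `π`. -/
theorem exists_root_near (a b : ℂ) (hb : b ≠ 0) (l : ℕ) :
    ∃ φ : ℂ → ℂ, Tendsto φ (𝓝 0) (𝓝 (l * Real.pi)) ∧
      ∀ᶠ ε in 𝓝 (0 : ℂ), b * Complex.sin (φ ε) = a * Complex.sin (ε * φ ε) := by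
  -- At `ε = 0` the equation is `b sin φ = 0`, with simple roots at the multiples of `π`; the
  -- implicit function theorem continues them to small `ε`.
  set f : ℂ × ℂ → ℂ := fun p => b * Complex.sin p.2 - a * Complex.sin (p.1 * p.2) with hf
  set u : ℂ × ℂ := (0, (l * Real.pi : ℂ)) with hu
  have hfu : f u = 0 := by simp [hf, hu, sin_natCast_mul_pi]
  have hd : ContDiff ℂ 1 f := by
    have h1 : ContDiff ℂ 1 Complex.sin := Complex.contDiff_sin
    exact (contDiff_const.mul (h1.comp contDiff_snd)).sub
      (contDiff_const.mul (h1.comp (contDiff_fst.mul contDiff_snd)))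
  have dfu : HasStrictFDerivAt f (fderiv ℂ f u) u :=
    hd.contDiffAt.hasStrictFDerivAt one_ne_zero
  have hinr : HasFDerivAt (fun y : ℂ => f (0, y)) (fderiv ℂ f u ∘L .inr ℂ ℂ ℂ) (l * Real.pi) :=
    dfu.hasFDerivAt.comp (l * Real.pi : ℂ) (hasFDerivAt_prodMk_right 0 (l * Real.pi : ℂ))
  have hinr' : HasDerivAt (fun y : ℂ => f (0, y)) (b * Complex.cos (l * Real.pi)) (l * Real.pi) := by
    simpa [hf] using (Complex.hasDerivAt_sin (l * Real.pi)).const_mul b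
  have hne : b * Complex.cos (l * Real.pi) ≠ 0 := by
    rw [cos_natCast_mul_pi]
    exact mul_ne_zero hb (pow_ne_zero _ (neg_ne_zero.2 one_ne_zero))
  have hinv : (fderiv ℂ f u ∘L .inr ℂ ℂ ℂ).IsInvertible := by
    refine ⟨ContinuousLinearEquiv.unitsEquivAut ℂ (Units.mk0 _ hne), ?_⟩
    rw [hinr.unique hinr'.hasFDerivAt]
    ext
    simp
  refine ⟨dfu.implicitFunctionOfProdDomain hinv, dfu.tendsto_implicitFunctionOfProdDomain hinv, ?_⟩
  filter_upwards [dfu.eventually_apply_implicitFunctionOfProdDomain hinv] with ε h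
  rw [hfu] at h
  exact sub_eq_zero.1 h

/-- Putting `φ = (m + 1) θ` and `ε = 1 / (m + 1)` turns the root condition into that of
`exists_root_near`, while the eigenvalue becomes `a cos θ - b cos φ`. Positivity of `l` keeps `φ`
away from the trivial root `0`, for which `sin θ` vanishes. -/
theorem exists_eigenvalue_tendsto (a b : ℂ) (hb : b ≠ 0) (l : ℕ) (hl : 0 < l) :
    ∃ μ : ℕ → ℂ, Tendsto μ atTop (𝓝 (a - (-1) ^ l * b)) ∧
      ∀ᶠ m in atTop, μ m ∈ spectrum ℂ (blockToeplitz m a b) := by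
  obtain ⟨φ, hφ, hroot⟩ := exists_root_near a b hb l
  set ε : ℕ → ℂ := fun m => ((m : ℂ) + 1)⁻¹ with hε
  have hε0 : Tendsto ε atTop (𝓝 0) := by
    have := tendsto_one_div_add_atTop_nhds_zero_nat (𝕜 := ℂ)
    simpa [hε] using this
  have hφm := hφ.comp hε0
  set θ : ℕ → ℂ := fun m => ε m * φ (ε m) with hθ
  have hθ0 : Tendsto θ atTop (𝓝 0) := by
    simpa using hε0.mul hφm
  refine ⟨fun m => a * Complex.cos (θ m) - b * Complex.cos (φ (ε m)), ?_, ?_⟩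
  · have h1 : Tendsto (fun m => Complex.cos (θ m)) atTop (𝓝 1) := by
      have := (Complex.continuous_cos.tendsto 0).comp hθ0
      rwa [Complex.cos_zero] at this
    have h2 : Tendsto (fun m => Complex.cos (φ (ε m))) atTop (𝓝 ((-1) ^ l)) := by
      have := (Complex.continuous_cos.tendsto _).comp hφm
      rwa [cos_natCast_mul_pi] at this
    simpa [mul_comm b] using (h1.const_mul a).sub (h2.const_mul b)
  · have hφne : ∀ᶠ m in atTop, φ (ε m) ≠ 0 := by
      refine hφm.eventually_ne ?_
      have : (Real.pi : ℂ) ≠ 0 := by exact_mod_cast Real.pi_ne_zero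
      have : (l : ℂ) ≠ 0 := by exact_mod_cast hl.ne'
      positivity
    have hθlt : ∀ᶠ m in atTop, ‖θ m‖ < 1 := by
      have := hθ0.norm
      rw [norm_zero] at this
      exact this.eventually_lt_const one_pos
    filter_upwards [hε0.eventually hroot, hφne, hθlt, eventually_gt_atTop 0] with m h1 h2 h3 hm
    have hm1 : (m : ℂ) + 1 ≠ 0 := by exact_mod_cast (Nat.succ_ne_zero m)
    have hθφ : ((m : ℂ) + 1) * θ m = φ (ε m) := by
      simp only [hθ, hε]
      field_simp
    have hθne : θ m ≠ 0 := mul_ne_zero (inv_ne_zero hm1) h2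
    have hs : Complex.sin (θ m) ≠ 0 := by
      rw [Ne, Complex.sin_eq_zero_iff]
      rintro ⟨k, hk⟩
      have hk0 : k ≠ 0 := by
        rintro rfl
        simp at hk
        exact hθne hk
      rw [hk, norm_mul, Complex.norm_intCast, Complex.norm_real, Real.norm_of_nonneg Real.pi_pos.le]
        at h3
      have : (1 : ℝ) ≤ |(k : ℝ)| := by exact_mod_cast Int.one_le_abs hk0
      nlinarith [Real.pi_gt_three]
    have h := mem_spectrum_blockToeplitz (a := a) (b := b) hm hs (by rw [hθφ]; exact h1)
    convert h using 1
    rw [eq_div_iff hs]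
    -- Expanding `b sin (φ - θ)` and replacing `b sin φ` by `a sin θ` leaves a multiple of `sin θ`.
    have e : (m : ℂ) * θ m = φ (ε m) - θ m := by rw [← hθφ]; ring
    rw [e, Complex.sin_sub]
    have h1' : b * Complex.sin (φ (ε m)) = a * Complex.sin (θ m) := h1
    linear_combination -Complex.cos (θ m) * h1'

/-- Squeeze between the norm bound and the eigenvalues for `l = 1` and `l = 2`. For `b = 0` the
matrix is nilpotent and the limit would be `0`. -/
theorem tendsto_spectralRadius_blockToeplitz (a b : ℂ) (hb : b ≠ 0) :
    Tendsto (fun m => spectralRadius ℂ (blockToeplitz m a b)) atTop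
      (𝓝 (ENNReal.ofReal (max ‖a + b‖ ‖a - b‖))) := by
  obtain ⟨μ, hμ, hμm⟩ := exists_eigenvalue_tendsto a b hb 1 one_pos
  obtain ⟨ν, hν, hνm⟩ := exists_eigenvalue_tendsto a b hb 2 two_pos
  have hmax : Tendsto (fun m => ENNReal.ofReal (max ‖μ m‖ ‖ν m‖)) atTop
      (𝓝 (ENNReal.ofReal (max ‖a + b‖ ‖a - b‖))) := by
    refine ENNReal.tendsto_ofReal (Tendsto.max ?_ ?_)
    · simpa using hμ.norm
    · simpa using hν.norm
  refine tendsto_of_tendsto_of_tendsto_of_le_of_le' hmax tendsto_const_nhds ?_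
    (Eventually.of_forall fun m => spectralRadius_blockToeplitz_le m a b)
  filter_upwards [hμm, hνm] with m h1 h2
  rw [ENNReal.ofReal_max]
  refine max_le ?_ ?_
  · rw [ofReal_norm, enorm_eq_nnnorm]
    exact le_iSup₂ (f := fun k (_ : k ∈ spectrum ℂ (blockToeplitz m a b)) => (‖k‖₊ : ℝ≥0∞)) _ h1
  · rw [ofReal_norm, enorm_eq_nnnorm]
    exact le_iSup₂ (f := fun k (_ : k ∈ spectrum ℂ (blockToeplitz m a b)) => (‖k‖₊ : ℝ≥0∞)) _ h2

/-! ### The Robin problem on an interval. -/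

/-- The general solution of `v'' = ζ² v`, normalized at `c`. -/
noncomputable def expSol (ζ : ℂ) (c : ℝ) (A B : ℂ) (x : ℝ) : ℂ :=
  A * Complex.exp (ζ * (x - c)) + B * Complex.exp (-(ζ * (x - c)))

theorem hasDerivAt_exp_mul (ζ : ℂ) (c x : ℝ) :
    HasDerivAt (fun x : ℝ => Complex.exp (ζ * (x - c))) (ζ * Complex.exp (ζ * (x - c))) x := by
  have h := (((Complex.ofRealCLM.hasDerivAt (x := x)).sub_const (c : ℂ)).const_mul ζ).cexp
  simpa [mul_comm] using h

theorem hasDerivAt_exp_neg_mul (ζ : ℂ) (c x : ℝ) :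
    HasDerivAt (fun x : ℝ => Complex.exp (-(ζ * (x - c))))
      (-ζ * Complex.exp (-(ζ * (x - c)))) x := by
  simpa using hasDerivAt_exp_mul (-ζ) c x

theorem hasDerivAt_expSol (ζ : ℂ) (c : ℝ) (A B : ℂ) (x : ℝ) :
    HasDerivAt (expSol ζ c A B) (ζ * expSol ζ c A (-B) x) x := by
  have h := ((hasDerivAt_exp_mul ζ c x).const_mul A).add
    ((hasDerivAt_exp_neg_mul ζ c x).const_mul B)
  refine h.congr_deriv ?_
  simp only [expSol]
  ring

theorem contDiff_expSol (ζ : ℂ) (c : ℝ) (A B : ℂ) : ContDiff ℝ 2 (expSol ζ c A B) := by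
  have h : ContDiff ℝ 2 fun x : ℝ => ζ * ((x : ℂ) - c) :=
    contDiff_const.mul (Complex.ofRealCLM.contDiff.sub contDiff_const)
  exact (contDiff_const.mul h.cexp).add (contDiff_const.mul h.neg.cexp)

theorem expSol_sub_expSol (ζ : ℂ) (c : ℝ) (A B A' B' : ℂ) (x : ℝ) :
    expSol ζ c A B x - expSol ζ c A' B' x = expSol ζ c (A - A') (B - B') x := by
  simp only [expSol]
  ring

theorem derivWithin_of_eqOn_expSol {p q : ℝ} (hpq : p < q) {ζ : ℂ} {c : ℝ} {A B : ℂ} {v : ℝ → ℂ}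
    (h : Set.EqOn v (expSol ζ c A B) (Set.Icc p q)) {x : ℝ} (hx : x ∈ Set.Icc p q) :
    derivWithin v (Set.Icc p q) x = ζ * expSol ζ c A (-B) x := by
  rw [derivWithin_congr h (h hx)]
  exact (hasDerivAt_expSol ζ c A B x).hasDerivWithinAt.derivWithin (uniqueDiffOn_Icc hpq x hx)

theorem opBl_of_eqOn_expSol (P : Params) {p q : ℝ} (hpq : p < q) {ζ : ℂ} {c : ℝ} {A B : ℂ}
    {v : ℝ → ℂ} (h : Set.EqOn v (expSol ζ c A B) (Set.Icc p q)) {x : ℝ} (hx : x ∈ Set.Icc p q) :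
    opBl P (Set.Icc p q) v x =
      expSol ζ c (-(ζ - P.α) * A) ((ζ + P.α) * B) x := by
  rw [opBl, derivWithin_of_eqOn_expSol hpq h hx, h hx]
  simp only [expSol]
  ring

theorem opBr_of_eqOn_expSol (P : Params) {p q : ℝ} (hpq : p < q) {ζ : ℂ} {c : ℝ} {A B : ℂ}
    {v : ℝ → ℂ} (h : Set.EqOn v (expSol ζ c A B) (Set.Icc p q)) {x : ℝ} (hx : x ∈ Set.Icc p q) :
    opBr P (Set.Icc p q) v x =
      expSol ζ c ((ζ + P.α) * A) (-(ζ - P.α) * B) x := by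
  rw [opBr, derivWithin_of_eqOn_expSol hpq h hx, h hx]
  simp only [expSol]
  ring

theorem zeta_sq (P : Params) :
    zeta P ^ 2 = Complex.I * (P.k : ℂ) * (P.σ : ℂ) - (P.k : ℂ) ^ 2 := by
  rw [zeta, one_div]
  exact Complex.cpow_ofNat_inv_pow _ 2

/-- `C²` solutions of `ℒ v = 0` are combinations of exponentials. -/
theorem exists_eqOn_expSol {P : Params} (hζ : zeta P ≠ 0) {p q : ℝ} (hpq : p < q) {v : ℝ → ℂ}
    (hv : ContDiffOn ℝ 2 v (Set.Icc p q))
    (heqn : ∀ x ∈ Set.Ioo p q, opL P (Set.Icc p q) v x = 0) (c : ℝ) :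
    ∃ A B, Set.EqOn v (expSol (zeta P) c A B) (Set.Icc p q) := by
  set S := Set.Icc p q with hS
  set ζ := zeta P with hζd
  have hu : UniqueDiffOn ℝ S := uniqueDiffOn_Icc hpq
  set v₁ := derivWithin v S with hv₁
  have hv₁c : ContDiffOn ℝ 1 v₁ S := hv.derivWithin hu (by norm_num)
  have hd : ∀ x ∈ S, HasDerivWithinAt v (v₁ x) S x := fun x hx =>
    (hv.differentiableOn two_ne_zero x hx).hasDerivWithinAt
  have hd₁ : ∀ x ∈ S, HasDerivWithinAt v₁ (derivWithin v₁ S x) S x := fun x hx =>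
    (hv₁c.differentiableOn one_ne_zero x hx).hasDerivWithinAt
  -- The equation is given only on the open interval; continuity of the second derivative carries it
  -- to the endpoints.
  have hode : Set.EqOn (derivWithin v₁ S) (fun x => ζ ^ 2 * v x) S := by
    have h0 : Set.EqOn (derivWithin v₁ S) (fun x => ζ ^ 2 * v x) (Set.Ioo p q) := by
      intro x hx
      have h := heqn x hx
      rw [opL, ← zeta_sq, iteratedDerivWithin_succ, iteratedDerivWithin_one] at h
      linear_combination -h
    refine h0.of_subset_closure (hv₁c.continuousOn_derivWithin hu le_rfl)
      (continuousOn_const.mul hv.continuousOn) Set.Ioo_subset_Icc_self ?_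
    rw [closure_Ioo hpq.ne]
  have hconst : ∀ f : ℝ → ℂ, (∀ x ∈ S, HasDerivWithinAt f 0 S x) → ∀ x ∈ S, f x = f p := by
    intro f hf
    refine constant_of_derivWithin_zero (fun x hx => (hf x hx).differentiableWithinAt) ?_
    exact fun x hx => (hf x (Set.Ico_subset_Icc_self hx)).derivWithin
      (hu x (Set.Ico_subset_Icc_self hx))
  -- Since `v'' - ζ² v` factors, `(v' - ζ v) e^{ζ(x - c)}` and `(v' + ζ v) e^{-ζ(x - c)}` are
  -- constant; eliminating `v'` recovers `v`.
  have h1 := hconst (fun x => (v₁ x - ζ * v x) * Complex.exp (ζ * (x - c))) (by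
    intro x hx
    have h := ((hd₁ x hx).sub ((hd x hx).const_mul ζ)).mul
      (hasDerivAt_exp_mul ζ c x).hasDerivWithinAt
    refine h.congr_deriv ?_
    rw [hode hx]
    simp only [Pi.sub_apply]
    ring)
  have h2 := hconst (fun x => (v₁ x + ζ * v x) * Complex.exp (-(ζ * (x - c)))) (by
    intro x hx
    have h := ((hd₁ x hx).add ((hd x hx).const_mul ζ)).mul
      (hasDerivAt_exp_neg_mul ζ c x).hasDerivWithinAt
    refine h.congr_deriv ?_
    rw [hode hx]
    simp only [Pi.add_apply]
    ring)
  generalize (v₁ p - ζ * v p) * Complex.exp (ζ * (p - c)) = K₁ at h1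
  generalize (v₁ p + ζ * v p) * Complex.exp (-(ζ * (p - c))) = K₂ at h2
  refine ⟨K₂ / (2 * ζ), -K₁ / (2 * ζ), fun x hx => ?_⟩
  have he : Complex.exp (ζ * (x - c)) * Complex.exp (-(ζ * (x - c))) = 1 := by
    rw [← Complex.exp_add, add_neg_cancel, Complex.exp_zero]
  rw [expSol, ← h1 x hx, ← h2 x hx]
  field_simp
  linear_combination (-2 * ζ * v x) * he

theorem iteratedDerivWithin_two_expSol {p q : ℝ} (hpq : p < q) (ζ : ℂ) (c : ℝ) (A B : ℂ) {x : ℝ}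
    (hx : x ∈ Set.Icc p q) :
    iteratedDerivWithin 2 (expSol ζ c A B) (Set.Icc p q) x = ζ ^ 2 * expSol ζ c A B x := by
  rw [iteratedDerivWithin_succ, iteratedDerivWithin_one]
  have h : Set.EqOn (derivWithin (expSol ζ c A B) (Set.Icc p q))
      (expSol ζ c (ζ * A) (-(ζ * B))) (Set.Icc p q) := by
    intro y hy
    rw [derivWithin_of_eqOn_expSol hpq (fun _ _ => rfl) hy]
    simp only [expSol]
    ring
  rw [derivWithin_of_eqOn_expSol hpq h hx]
  simp only [expSol]
  ring

/-- The determinant of the Robin problem on an interval of length `l`. -/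
noncomputable def robinDet (ζ α : ℂ) (l : ℝ) : ℂ :=
  (ζ + α) ^ 2 * Complex.exp (ζ * l) - (ζ - α) ^ 2 * Complex.exp (-(ζ * l))

/-- Cramer's rule, kept free of division; it gives uniqueness, the witnesses for existence, and the
formulas for the traces. -/
theorem coeffs_of_robin_data {ζ α : ℂ} {l : ℝ} {A B gl gr : ℂ}
    (hl : -(ζ - α) * A + (ζ + α) * B = gl)
    (hr : (ζ + α) * A * Complex.exp (ζ * l) + -(ζ - α) * B * Complex.exp (-(ζ * l)) = gr) :
    A * robinDet ζ α l = (ζ + α) * gr + (ζ - α) * Complex.exp (-(ζ * l)) * gl ∧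
      B * robinDet ζ α l = (ζ + α) * Complex.exp (ζ * l) * gl + (ζ - α) * gr := by
  rw [← hl, ← hr, robinDet]
  constructor <;> ring

theorem expSol_left (ζ : ℂ) (p : ℝ) (A B : ℂ) : expSol ζ p A B p = A + B := by
  simp [expSol]

theorem existsUnique_solvesBVP {P : Params} (hζ : zeta P ≠ 0) {p q : ℝ} (hpq : p < q)
    (hD : robinDet (zeta P) P.α (q - p) ≠ 0) (gl gr : ℂ) :
    ∃ v : ℝ → ℂ, SolvesBVP P p q gl gr v ∧
      ∀ v' : ℝ → ℂ, SolvesBVP P p q gl gr v' → Set.EqOn v' v (Set.Icc p q) := by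
  set ζ := zeta P with hζd
  set α := P.α with hα
  set E := Complex.exp (ζ * (q - p : ℝ)) with hE
  set E' := Complex.exp (-(ζ * (q - p : ℝ))) with hE'
  have hEE : E * E' = 1 := by rw [hE, hE', ← Complex.exp_add, add_neg_cancel, Complex.exp_zero]
  set D := robinDet ζ α (q - p) with hDd
  have hDe : D = (ζ + α) ^ 2 * E - (ζ - α) ^ 2 * E' := rfl
  set A := ((ζ + α) * gr + (ζ - α) * E' * gl) / D with hA
  set B := ((ζ + α) * E * gl + (ζ - α) * gr) / D with hB
  have hpm : p ∈ Set.Icc p q := Set.left_mem_Icc.2 hpq.le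
  have hqm : q ∈ Set.Icc p q := Set.right_mem_Icc.2 hpq.le
  refine ⟨expSol ζ p A B, ⟨(contDiff_expSol ζ p A B).contDiffOn, ?_, ?_, ?_⟩, ?_⟩
  · intro x hx
    rw [opL, iteratedDerivWithin_two_expSol hpq _ _ _ _ (Set.Ioo_subset_Icc_self hx), ← zeta_sq, ← hζd]
    ring
  · rw [opBl_of_eqOn_expSol P hpq (fun _ _ => rfl) hpm, expSol_left, hA, hB, ← hα]
    field_simp
    rw [hDe]
    ring
  · rw [opBr_of_eqOn_expSol P hpq (fun _ _ => rfl) hqm, expSol, ← Complex.ofReal_sub, ← hE, ← hE',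
      hA, hB, ← hα]
    field_simp
    rw [hDe]
    ring
  · intro v' hv'
    obtain ⟨A', B', h⟩ := exists_eqOn_expSol hζ hpq hv'.contDiffOn hv'.eqn p
    have hl := hv'.left
    have hr := hv'.right
    rw [opBl_of_eqOn_expSol P hpq h hpm, expSol_left] at hl
    rw [opBr_of_eqOn_expSol P hpq h hqm, expSol, ← Complex.ofReal_sub] at hr
    obtain ⟨h1, h2⟩ := coeffs_of_robin_data hl hr
    rw [← eq_div_iff hD] at h1 h2
    rw [h1, h2] at h
    exact h

/-! ### Propagation of the Robin data of the errors. -/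

section Run

variable {P : Params} {N : ℕ} {x₀ : ℝ} {g₁ g₂ : ℂ} {u : ℝ → ℂ} {w : ℕ → ℕ → ℝ → ℂ}

theorem bPt_eq (P : Params) (x₀ : ℝ) (j : ℕ) : bPt P x₀ j = aPt P x₀ (j + 1) + 2 * P.δ := by
  simp only [bPt, aPt]
  push_cast
  ring

theorem aPt_succ (P : Params) (x₀ : ℝ) (j : ℕ) : aPt P x₀ (j + 1) = aPt P x₀ j + P.L := by
  simp only [aPt]
  push_cast
  ring

theorem aPt_mono (hL : 0 < P.L) (x₀ : ℝ) {i j : ℕ} (hij : i ≤ j) : aPt P x₀ i ≤ aPt P x₀ j := by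
  have : (i : ℝ) ≤ j := by exact_mod_cast hij
  simp only [aPt]
  gcongr

theorem aPt_lt_bPt (hL : 0 < P.L) (hδ : 0 < P.δ) (x₀ : ℝ) (j : ℕ) : aPt P x₀ j < bPt P x₀ j := by
  simp only [bPt]
  linarith

theorem dom_subset (hL : 0 < P.L) (x₀ : ℝ) {j : ℕ} (h1 : 1 ≤ j) (hN : j ≤ N) :
    dom P x₀ j ⊆ Set.Icc (aPt P x₀ 1) (bPt P x₀ N) := by
  refine Set.Icc_subset_Icc (aPt_mono hL x₀ h1) ?_
  have := aPt_mono hL x₀ hN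
  simp only [bPt]
  linarith

theorem opBl_sub (P : Params) {p q x : ℝ} {v₁ v₂ : ℝ → ℂ}
    (h₁ : DifferentiableWithinAt ℝ v₁ (Set.Icc p q) x)
    (h₂ : DifferentiableWithinAt ℝ v₂ (Set.Icc p q) x) :
    opBl P (Set.Icc p q) (fun y => v₁ y - v₂ y) x =
      opBl P (Set.Icc p q) v₁ x - opBl P (Set.Icc p q) v₂ x := by
  simp only [opBl, derivWithin_fun_sub h₁ h₂]
  ring

theorem opBr_sub (P : Params) {p q x : ℝ} {v₁ v₂ : ℝ → ℂ}
    (h₁ : DifferentiableWithinAt ℝ v₁ (Set.Icc p q) x)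
    (h₂ : DifferentiableWithinAt ℝ v₂ (Set.Icc p q) x) :
    opBr P (Set.Icc p q) (fun y => v₁ y - v₂ y) x =
      opBr P (Set.Icc p q) v₁ x - opBr P (Set.Icc p q) v₂ x := by
  simp only [opBr, derivWithin_fun_sub h₁ h₂]
  ring

theorem IsSchwarzRun.differentiableOn_iterate (h : IsSchwarzRun P N x₀ g₁ g₂ u w) (n : ℕ) {j : ℕ}
    (h1 : 1 ≤ j) (hN : j ≤ N) : DifferentiableOn ℝ (w n j) (dom P x₀ j) := by
  cases n with
  | zero => exact (h.init j h1 hN).differentiableOn one_ne_zero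
  | succ n => exact (h.step n j h1 hN).contDiffOn.differentiableOn two_ne_zero

theorem IsSchwarzRun.differentiableOn_exact (hL : 0 < P.L) (h : IsSchwarzRun P N x₀ g₁ g₂ u w)
    {j : ℕ} (h1 : 1 ≤ j) (hN : j ≤ N) : DifferentiableOn ℝ u (dom P x₀ j) :=
  (h.exact_sol.contDiffOn.differentiableOn two_ne_zero).mono (dom_subset hL x₀ h1 hN)

/-- At an endpoint the derivative within a set depends on the set. This lets the traces of `u` taken
from neighbouring subdomains be identified. -/
theorem derivWithin_exact (hL : 0 < P.L) (hδ : 0 < P.δ) (h : IsSchwarzRun P N x₀ g₁ g₂ u w)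
    {j : ℕ} (h1 : 1 ≤ j) (hN : j ≤ N) {x : ℝ} (hx : x ∈ dom P x₀ j) :
    derivWithin u (dom P x₀ j) x =
      derivWithin u (Set.Icc (aPt P x₀ 1) (bPt P x₀ N)) x :=
  derivWithin_subset (dom_subset hL x₀ h1 hN) (uniqueDiffOn_Icc (aPt_lt_bPt hL hδ x₀ j) x hx)
    (h.exact_sol.contDiffOn.differentiableOn two_ne_zero x (dom_subset hL x₀ h1 hN hx))

theorem aPt_mem_dom (hL : 0 < P.L) (hδ : 0 < P.δ) (x₀ : ℝ) (j : ℕ) :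
    aPt P x₀ j ∈ dom P x₀ j := Set.left_mem_Icc.2 (aPt_lt_bPt hL hδ x₀ j).le

theorem bPt_mem_dom (hL : 0 < P.L) (hδ : 0 < P.δ) (x₀ : ℝ) (j : ℕ) :
    bPt P x₀ j ∈ dom P x₀ j := Set.right_mem_Icc.2 (aPt_lt_bPt hL hδ x₀ j).le

theorem aPt_succ_mem_dom (hL : 0 < P.L) (hδ : 0 < P.δ) (x₀ : ℝ) (j : ℕ) :
    aPt P x₀ (j + 1) ∈ dom P x₀ j := by
  rw [aPt_succ, dom, bPt]
  constructor <;> linarith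

theorem bPt_mem_dom_succ (hL : 0 < P.L) (hδ : 0 < P.δ) (x₀ : ℝ) (j : ℕ) :
    bPt P x₀ j ∈ dom P x₀ (j + 1) := by
  rw [bPt_eq, dom, bPt]
  constructor <;> linarith

/-- The left Robin datum of the error is passed on from the left neighbour. -/
theorem opBl_error (hL : 0 < P.L) (hδ : 0 < P.δ) (h : IsSchwarzRun P N x₀ g₁ g₂ u w)
    (n : ℕ) {j : ℕ} (h1 : 1 ≤ j) (hN : j ≤ N) :
    opBl P (dom P x₀ j) (fun x => u x - w (n + 1) j x) (aPt P x₀ j) =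
      if j = 1 then 0 else
        opBl P (dom P x₀ (j - 1)) (fun x => u x - w n (j - 1) x) (aPt P x₀ j) := by
  have hm := aPt_mem_dom hL hδ x₀ j
  rw [dom, opBl_sub P (h.differentiableOn_exact hL h1 hN _ hm)
    (h.differentiableOn_iterate _ h1 hN _ hm), (h.step n j h1 hN).left, ← dom]
  have hu : opBl P (dom P x₀ j) u (aPt P x₀ j) =
      opBl P (Set.Icc (aPt P x₀ 1) (bPt P x₀ N)) u (aPt P x₀ j) := by
    rw [opBl, opBl, derivWithin_exact hL hδ h h1 hN hm]
  rw [hu]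
  split_ifs with hj
  · subst hj
    rw [h.exact_sol.left, sub_self]
  · obtain ⟨i, rfl⟩ : ∃ i, j = i + 1 := ⟨j - 1, by omega⟩
    have hm' := aPt_succ_mem_dom hL hδ x₀ i
    have hi : 1 ≤ i := by omega
    have hiN : i ≤ N := by omega
    rw [Nat.add_sub_cancel]
    rw [dom, opBl_sub P (h.differentiableOn_exact hL hi hiN _ hm')
      (h.differentiableOn_iterate _ hi hiN _ hm'), ← dom]
    congr 1
    rw [opBl, opBl, derivWithin_exact hL hδ h hi hiN hm']

/-- The right Robin datum of the error is passed on from the right neighbour. -/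
theorem opBr_error (hL : 0 < P.L) (hδ : 0 < P.δ) (h : IsSchwarzRun P N x₀ g₁ g₂ u w)
    (n : ℕ) {j : ℕ} (h1 : 1 ≤ j) (hN : j ≤ N) :
    opBr P (dom P x₀ j) (fun x => u x - w (n + 1) j x) (bPt P x₀ j) =
      if j = N then 0 else
        opBr P (dom P x₀ (j + 1)) (fun x => u x - w n (j + 1) x) (bPt P x₀ j) := by
  have hm := bPt_mem_dom hL hδ x₀ j
  rw [dom, opBr_sub P (h.differentiableOn_exact hL h1 hN _ hm)
    (h.differentiableOn_iterate _ h1 hN _ hm), (h.step n j h1 hN).right, ← dom]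
  have hu : opBr P (dom P x₀ j) u (bPt P x₀ j) =
      opBr P (Set.Icc (aPt P x₀ 1) (bPt P x₀ N)) u (bPt P x₀ j) := by
    rw [opBr, opBr, derivWithin_exact hL hδ h h1 hN hm]
  rw [hu]
  split_ifs with hj
  · subst hj
    rw [h.exact_sol.right, sub_self]
  · have hm' := bPt_mem_dom_succ hL hδ x₀ j
    have hi : 1 ≤ j + 1 := by omega
    have hiN : j + 1 ≤ N := by omega
    rw [dom, opBr_sub P (h.differentiableOn_exact hL hi hiN _ hm')
      (h.differentiableOn_iterate _ hi hiN _ hm'), ← dom]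
    congr 1
    rw [opBr, opBr, derivWithin_exact hL hδ h hi hiN hm']

theorem coeffD_eq (P : Params) : coeffD P = robinDet (zeta P) P.α (P.L + 2 * P.δ) := by
  rw [coeffD, robinDet]
  push_cast
  rw [add_comm (P.L : ℂ)]

/-- Only iterates `n + 1` are covered, because an initial guess need not solve the equation. -/
theorem exists_eqOn_error (hζ : zeta P ≠ 0) (hL : 0 < P.L) (hδ : 0 < P.δ)
    (h : IsSchwarzRun P N x₀ g₁ g₂ u w) (n : ℕ) {j : ℕ} (h1 : 1 ≤ j) (hN : j ≤ N) :
    ∃ A B, Set.EqOn (fun x => u x - w (n + 1) j x) (expSol (zeta P) (aPt P x₀ j) A B)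
      (dom P x₀ j) := by
  have hNpos : aPt P x₀ 1 < bPt P x₀ N :=
    (aPt_mono hL x₀ (h1.trans hN)).trans_lt (aPt_lt_bPt hL hδ x₀ N)
  obtain ⟨A, B, hu⟩ := exists_eqOn_expSol hζ hNpos h.exact_sol.contDiffOn h.exact_sol.eqn
    (aPt P x₀ j)
  obtain ⟨A', B', hw⟩ := exists_eqOn_expSol hζ (aPt_lt_bPt hL hδ x₀ j)
    (h.step n j h1 hN).contDiffOn (h.step n j h1 hN).eqn (aPt P x₀ j)
  refine ⟨A - A', B - B', fun x hx => ?_⟩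
  simp only
  rw [hu (dom_subset hL x₀ h1 hN hx), hw hx, expSol_sub_expSol]

/-- The Robin traces of a solution on a subdomain at the interior interfaces, in terms of its
boundary data. -/
theorem robin_traces (hL : 0 < P.L) (hδ : 0 < P.δ) (hD : coeffD P ≠ 0) {j : ℕ} {e : ℝ → ℂ}
    {A B : ℂ} (he : Set.EqOn e (expSol (zeta P) (aPt P x₀ j) A B) (dom P x₀ j)) :
    opBr P (dom P x₀ j) e (aPt P x₀ j + 2 * P.δ) =
        coeffA P * opBr P (dom P x₀ j) e (bPt P x₀ j) +
          coeffB P * opBl P (dom P x₀ j) e (aPt P x₀ j) ∧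
      opBl P (dom P x₀ j) e (aPt P x₀ (j + 1)) =
        coeffA P * opBl P (dom P x₀ j) e (aPt P x₀ j) +
          coeffB P * opBr P (dom P x₀ j) e (bPt P x₀ j) := by
  have hab := aPt_lt_bPt hL hδ x₀ j
  have ha := aPt_mem_dom hL hδ x₀ j
  have hb := bPt_mem_dom hL hδ x₀ j
  have ha' := aPt_succ_mem_dom hL hδ x₀ j
  have hb' : aPt P x₀ j + 2 * P.δ ∈ dom P x₀ j := by
    rw [dom, bPt]
    constructor <;> linarith
  have el := opBl_of_eqOn_expSol P hab he ha
  have er := opBr_of_eqOn_expSol P hab he hb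
  rw [← dom] at el er
  have hlen : ((bPt P x₀ j : ℝ) : ℂ) - (aPt P x₀ j : ℝ) = ((P.L + 2 * P.δ : ℝ) : ℂ) := by
    rw [← Complex.ofReal_sub, bPt]
    congr 1
    ring
  rw [expSol_left] at el
  rw [expSol, hlen] at er
  obtain ⟨hA, hB⟩ := coeffs_of_robin_data el.symm er.symm
  rw [← coeffD_eq] at hA hB
  have fr := opBr_of_eqOn_expSol P hab he hb'
  have fl := opBl_of_eqOn_expSol P hab he ha'
  rw [← dom] at fr fl
  rw [fr, fl, aPt_succ]
  generalize opBl P (dom P x₀ j) e (aPt P x₀ j) = gl at *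
  generalize opBr P (dom P x₀ j) e (bPt P x₀ j) = gr at *
  simp only [expSol, coeffA, coeffB]
  rw [← eq_div_iff hD] at hA hB
  -- All exponents are split into `±ζ L` and `±ζ δ`, leaving rational identities in four
  -- exponentials with `F F' = G G' = 1`.
  have e1 : zeta P * (((aPt P x₀ j + 2 * P.δ : ℝ) : ℂ) - (aPt P x₀ j : ℝ)) =
      zeta P * P.δ + zeta P * P.δ := by push_cast; ring
  have e2 : zeta P * (((aPt P x₀ j + P.L : ℝ) : ℂ) - (aPt P x₀ j : ℝ)) =
      zeta P * P.L := by push_cast; ring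
  have e3 : 2 * zeta P * P.δ = zeta P * P.δ + zeta P * P.δ := by ring
  have e4 : zeta P * ((P.L + 2 * P.δ : ℝ) : ℂ) =
      zeta P * P.L + (zeta P * P.δ + zeta P * P.δ) := by push_cast; ring
  rw [e1, e2, e3, hA, hB, e4]
  have k1 : Complex.exp (zeta P * P.L) * Complex.exp (-(zeta P * P.L)) = 1 := by
    rw [← Complex.exp_add, add_neg_cancel, Complex.exp_zero]
  have k2 : Complex.exp (zeta P * P.δ) * Complex.exp (-(zeta P * P.δ)) = 1 := by
    rw [← Complex.exp_add, add_neg_cancel, Complex.exp_zero]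
  simp only [Complex.exp_add, neg_add]
  generalize Complex.exp (zeta P * P.L) = F at *
  generalize Complex.exp (-(zeta P * P.L)) = F' at *
  generalize Complex.exp (zeta P * P.δ) = G at *
  generalize Complex.exp (-(zeta P * P.δ)) = G' at *
  have k3 : G ^ 2 * G' ^ 2 = 1 := by rw [← mul_pow, k2, one_pow]
  have m1 : F' * G' ^ 2 * G ^ 2 = F' := by linear_combination F' * k3
  have m2 : F * G ^ 2 * G' ^ 2 = F := by linear_combination F * k3
  constructor
  · field_simp
    linear_combination (zeta P ^ 2 - P.α ^ 2) * gl * (m1 - m2)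
  · field_simp
    linear_combination (((zeta P + P.α) ^ 2 * G ^ 2 - (zeta P - P.α) ^ 2 * G' ^ 2) * gl) * k1

/-- The interior traces of a new error are combinations of its own boundary data (`robin_traces`),
and these are the neighbours' previous traces (`opBl_error`, `opBr_error`). The old errors need not
solve the equation, so `n = 0` is included. -/
theorem interfaceData_succ (hζ : zeta P ≠ 0) (hL : 0 < P.L) (hδ : 0 < P.δ) (hD : coeffD P ≠ 0)
    (h : IsSchwarzRun P N x₀ g₁ g₂ u w) (n : ℕ) :
    interfaceData P N x₀ u (w (n + 1)) = (iterMatrix P N).mulVec (interfaceData P N x₀ u (w n)) := by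
  funext ⟨i, s⟩
  have hi := i.2
  fin_cases s
  · have h1 : 1 ≤ (i : ℕ) + 2 := by omega
    have hN : (i : ℕ) + 2 ≤ N := by omega
    obtain ⟨A, B, he⟩ := exists_eqOn_error hζ hL hδ h n h1 hN
    have ht := (robin_traces hL hδ hD he).1
    rw [opBl_error hL hδ h n h1 hN, opBr_error hL hδ h n h1 hN,
      if_neg (show ¬ ((i : ℕ) + 2 = 1) by omega)] at ht
    rw [show aPt P x₀ (i + 2) + 2 * P.δ = bPt P x₀ (i + 1) from (bPt_eq P x₀ (i + 1)).symm] at ht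
    simp only [Fin.zero_eta, iterMatrix, blockToeplitz_mulVec_zero]
    simp only [interfaceData, if_true, one_ne_zero, if_false]
    rw [ht, add_comm]
    congr 2
    -- The outer boundary of the last subdomain carries exact data, so its error datum is the zero
    -- default of the last row.
    by_cases hc : (i : ℕ) + 2 = N
    · rw [if_pos hc, dif_neg (by omega)]
    · rw [if_neg hc, dif_pos (by omega)]
  · have h1 : 1 ≤ (i : ℕ) + 1 := by omega
    have hN : (i : ℕ) + 1 ≤ N := by omega
    obtain ⟨A, B, he⟩ := exists_eqOn_error hζ hL hδ h n h1 hN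
    have ht := (robin_traces hL hδ hD he).2
    rw [opBl_error hL hδ h n h1 hN, opBr_error hL hδ h n h1 hN,
      if_neg (show ¬ ((i : ℕ) + 1 = N) by omega)] at ht
    simp only [Fin.mk_one, iterMatrix, blockToeplitz_mulVec_one]
    simp only [interfaceData, if_true, one_ne_zero, if_false]
    rw [ht, add_comm]
    congr 2
    by_cases hc : 0 < (i : ℕ)
    · rw [if_neg (by omega), if_pos hc, Nat.add_sub_cancel, Nat.sub_add_cancel hc,
        show (i : ℕ) - 1 + 2 = i + 1 by omega]
    · rw [if_pos (by omega), if_neg hc]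

end Run

/-! ### Monotonicity of the Robin combinations and nonvanishing of the determinant. -/

/-- `‖(ζ + i) e^{ζ s} + ε (ζ - i) e^{-ζ s}‖² / 4` for `ζ = x + i y`, `y² = 1 + x²`, `ε = ±1`. -/
noncomputable def energy (ε x y s : ℝ) : ℝ :=
  y ^ 2 * Real.cosh (2 * x * s) + y * Real.sinh (2 * x * s) +
    ε * (x ^ 2 * Real.cos (2 * y * s) - x * Real.sin (2 * y * s))

/-- The constraint `y² = 1 + x²` gives `|ζ ± i|² = 2 y (y ± 1)` and reduces the cross term to `x²
cos - x sin`. -/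
theorem normSq_exp_combination {ε x y : ℝ} (hε : ε ^ 2 = 1) (hxy : y ^ 2 = 1 + x ^ 2) (s : ℝ) :
    Complex.normSq (((x + y * Complex.I) + Complex.I) * Complex.exp ((x + y * Complex.I) * s) +
      ε * (((x + y * Complex.I) - Complex.I) * Complex.exp (-((x + y * Complex.I) * s)))) =
      4 * energy ε x y s := by
  have e1 : Complex.exp ((x + y * Complex.I) * s) =
      (Real.exp (x * s) : ℂ) * (Real.cos (y * s) + Real.sin (y * s) * Complex.I) := by
    rw [show ((x : ℂ) + y * Complex.I) * s = (x * s : ℝ) + (y * s : ℝ) * Complex.I by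
      push_cast; ring, Complex.exp_add, Complex.exp_mul_I]
    push_cast
    ring
  have e2 : Complex.exp (-((x + y * Complex.I) * s)) =
      (Real.exp (-(x * s)) : ℂ) * (Real.cos (y * s) - Real.sin (y * s) * Complex.I) := by
    rw [show -(((x : ℂ) + y * Complex.I) * s) = (-(x * s) : ℝ) + (-(y * s) : ℝ) * Complex.I by
      push_cast; ring, Complex.exp_add, Complex.exp_mul_I]
    push_cast
    rw [Complex.cos_neg, Complex.sin_neg]
    ring
  have hE : Real.exp (x * s) * Real.exp (-(x * s)) = 1 := by
    rw [← Real.exp_add, add_neg_cancel, Real.exp_zero]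
  have hc := Real.sin_sq_add_cos_sq (y * s)
  have d1 : Real.exp (2 * x * s) = Real.exp (x * s) ^ 2 := by
    rw [sq, ← Real.exp_add]; congr 1; ring
  have d2 : Real.exp (-(2 * x * s)) = Real.exp (-(x * s)) ^ 2 := by
    rw [sq, ← Real.exp_add]; congr 1; ring
  have d3 : Real.cos (2 * y * s) = Real.cos (y * s) ^ 2 - Real.sin (y * s) ^ 2 := by
    rw [mul_assoc, Real.cos_two_mul']
  have d4 : Real.sin (2 * y * s) = 2 * Real.sin (y * s) * Real.cos (y * s) := by
    rw [mul_assoc, Real.sin_two_mul]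
  rw [e1, e2, energy, Real.cosh_eq, Real.sinh_eq, d1, d2, d3, d4]
  generalize Real.exp (x * s) = E at *
  generalize Real.exp (-(x * s)) = F at *
  generalize Real.cos (y * s) = c at *
  generalize Real.sin (y * s) = t at *
  rw [Complex.normSq_apply]
  simp only [Complex.add_re, Complex.add_im, Complex.mul_re, Complex.mul_im, Complex.ofReal_re,
    Complex.ofReal_im, Complex.I_re, Complex.I_im, Complex.sub_re, Complex.sub_im]
  have hx : x ^ 2 = y ^ 2 - 1 := by linarith
  have : (E ^ 2 * (x ^ 2 + (y + 1) ^ 2) + ε ^ 2 * F ^ 2 * (x ^ 2 + (y - 1) ^ 2)) * (t ^ 2 + c ^ 2) +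
      2 * ε * (E * F) * ((x ^ 2 + y ^ 2 - 1) * (c ^ 2 - t ^ 2) - 4 * x * t * c) =
    4 * (y ^ 2 * ((E ^ 2 + F ^ 2) / 2) + y * ((E ^ 2 - F ^ 2) / 2) +
      ε * (x ^ 2 * (c ^ 2 - t ^ 2) - x * (2 * t * c))) := by
    rw [hc, hE, hε]
    linear_combination (E ^ 2 + F ^ 2 - 2 * ε * (c ^ 2 - t ^ 2)) * hx
  rw [← this]
  ring

theorem hasDerivAt_energy (ε x y s : ℝ) :
    HasDerivAt (energy ε x y) (2 * x * y * (y * Real.sinh (2 * x * s) + Real.cosh (2 * x * s) -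
      ε * (x * Real.sin (2 * y * s) + Real.cos (2 * y * s)))) s := by
  have hx : HasDerivAt (fun s : ℝ => 2 * x * s) (2 * x) s := by
    simpa using (hasDerivAt_id s).const_mul (2 * x)
  have hy : HasDerivAt (fun s : ℝ => 2 * y * s) (2 * y) s := by
    simpa using (hasDerivAt_id s).const_mul (2 * y)
  have h := ((hx.cosh.const_mul (y ^ 2)).add (hx.sinh.const_mul y)).add
    (((hy.cos.const_mul (x ^ 2)).sub (hy.sin.const_mul x)).const_mul ε)
  refine h.congr_deriv ?_
  ring

/-- Both sides are compared with `2 x y s`, by `|sin t| ≤ t` and `t ≤ sinh t`. -/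
theorem mul_sin_le_mul_sinh {ε x y s : ℝ} (hε : |ε| ≤ 1) (hx : 0 < x) (hy : 0 < y) (hs : 0 ≤ s) :
    ε * (x * Real.sin (2 * y * s)) ≤ y * Real.sinh (2 * x * s) := by
  have h1 : ε * Real.sin (2 * y * s) ≤ 2 * y * s := by
    have h2 := Real.abs_sin_le_abs (x := 2 * y * s)
    rw [abs_of_nonneg (show 0 ≤ 2 * y * s by positivity)] at h2
    calc ε * Real.sin (2 * y * s) ≤ |ε * Real.sin (2 * y * s)| := le_abs_self _
      _ = |ε| * |Real.sin (2 * y * s)| := abs_mul _ _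
      _ ≤ 1 * (2 * y * s) := by gcongr
      _ = _ := one_mul _
  have h3 : 2 * x * s ≤ Real.sinh (2 * x * s) := Real.self_le_sinh_iff.2 (by positivity)
  nlinarith [mul_le_mul_of_nonneg_left h1 hx.le, mul_le_mul_of_nonneg_left h3 hy.le]

theorem energy_strictMonoOn {ε x y : ℝ} (hε : |ε| ≤ 1) (hx : 0 < x) (hy : 0 < y) :
    StrictMonoOn (energy ε x y) (Set.Ici 0) := by
  refine strictMonoOn_of_deriv_pos (convex_Ici 0)
    (fun s _ => (hasDerivAt_energy ε x y s).continuousAt.continuousWithinAt) fun s hs => ?_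
  rw [interior_Ici, Set.mem_Ioi] at hs
  rw [(hasDerivAt_energy ε x y s).deriv]
  have h1 := mul_sin_le_mul_sinh hε hx hy hs.le
  have h2 : ε * Real.cos (2 * y * s) ≤ 1 := by
    calc ε * Real.cos (2 * y * s) ≤ |ε * Real.cos (2 * y * s)| := le_abs_self _
      _ = |ε| * |Real.cos (2 * y * s)| := abs_mul _ _
      _ ≤ 1 * 1 := by gcongr; exact Real.abs_cos_le_one _
      _ = 1 := one_mul _
  have h3 : 1 < Real.cosh (2 * x * s) := Real.one_lt_cosh.2 (by positivity)
  have : 0 < 2 * x * y := by positivity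
  refine mul_pos this ?_
  linarith

theorem energy_neg_le {ε x y s : ℝ} (hε : |ε| ≤ 1) (hx : 0 < x) (hy : 0 < y) (hs : 0 ≤ s) :
    energy ε x y (-s) ≤ energy ε x y s := by
  have h := mul_sin_le_mul_sinh hε hx hy hs
  simp only [energy, mul_neg, Real.cosh_neg, Real.sinh_neg, Real.cos_neg, Real.sin_neg]
  linarith

/-- Negative `s` must be allowed, since `δ - L/2` has no fixed sign. -/
theorem energy_lt_energy {ε x y s t : ℝ} (hε : |ε| ≤ 1) (hx : 0 < x) (hy : 0 < y)
    (hst : |s| < t) : energy ε x y s < energy ε x y t := by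
  have h1 : energy ε x y s ≤ energy ε x y |s| := by
    rcases abs_cases s with ⟨h, _⟩ | ⟨h, hs⟩
    · rw [h]
    · have := energy_neg_le hε hx hy (abs_nonneg s)
      rwa [h, neg_neg, ← h] at this
  exact h1.trans_lt (energy_strictMonoOn hε hx hy (abs_nonneg s)
    ((abs_nonneg s).trans hst.le) hst)

/-- The two factors of the determinant of the Robin problem on an interval of length `2 s`. -/
noncomputable def expComb (ε : ℝ) (ζ α : ℂ) (s : ℝ) : ℂ :=
  (ζ + α) * Complex.exp (ζ * s) + ε * ((ζ - α) * Complex.exp (-(ζ * s)))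

theorem norm_expComb_lt {ε : ℝ} (hε : ε ^ 2 = 1) {ζ : ℂ} (hre : 0 < ζ.re) (him : 0 < ζ.im)
    (h : (ζ ^ 2).re = -1) {s t : ℝ} (hst : |s| < t) :
    ‖expComb ε ζ Complex.I s‖ < ‖expComb ε ζ Complex.I t‖ := by
  have hxy : ζ.im ^ 2 = 1 + ζ.re ^ 2 := by
    rw [sq, Complex.mul_re] at h
    linarith
  have hε1 : |ε| ≤ 1 := by
    rw [← sq_le_one_iff_abs_le_one, hε]
  have key : ∀ s, ‖expComb ε ζ Complex.I s‖ ^ 2 = 4 * energy ε ζ.re ζ.im s := by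
    intro s
    rw [← Complex.normSq_eq_norm_sq, ← normSq_exp_combination hε hxy, Complex.re_add_im, expComb]
  refine lt_of_pow_lt_pow_left₀ 2 (norm_nonneg _) ?_
  rw [key, key]
  linarith [energy_lt_energy hε1 hre him hst]

theorem cpow_half_re_nonneg (z : ℂ) : 0 ≤ (z ^ (1 / 2 : ℂ)).re := by
  have h : |(z ^ (1 / 2 : ℂ)).arg| ≤ Real.pi / 2 ∨ z = 0 := by
    rcases eq_or_ne z 0 with hz | hz
    · exact Or.inr hz
    left
    have e : z ^ (1 / 2 : ℂ) =
        (Real.exp (Real.log ‖z‖ / 2) : ℝ) * Complex.exp ((z.arg / 2 : ℝ) * Complex.I) := by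
      rw [Complex.cpow_def_of_ne_zero hz, Complex.ofReal_exp, ← Complex.exp_add, Complex.log]
      congr 1
      push_cast
      ring
    have h1 := Complex.neg_pi_lt_arg z
    have h2 := Complex.arg_le_pi z
    rw [e, Complex.arg_real_mul _ (Real.exp_pos _), Complex.arg_exp_mul_I,
      (toIocMod_eq_self Real.two_pi_pos).2 ⟨by linarith, by linarith⟩, abs_le]
    constructor <;> linarith
  rcases h with h | rfl
  · exact Complex.abs_arg_le_pi_div_two_iff.1 h
  · simp

/-- The principal branch gives `Re ζ ≥ 0`, and `2 Re ζ Im ζ = k σ > 0` forces both to be positive.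
-/
theorem zeta_re_pos_and_im_pos {P : Params} (hk : 0 < P.k) (hσ : 0 < P.σ) :
    0 < (zeta P).re ∧ 0 < (zeta P).im := by
  have h0 : 0 ≤ (zeta P).re := cpow_half_re_nonneg _
  have h := congrArg Complex.im (zeta_sq P)
  have him : (Complex.I * (P.k : ℂ) * (P.σ : ℂ) - (P.k : ℂ) ^ 2).im = P.k * P.σ := by
    simp [sq]
  rw [him, sq, Complex.mul_im] at h
  have hpos : 0 < (zeta P).re * (zeta P).im := by
    have := mul_pos hk hσ
    linarith
  have hre : 0 < (zeta P).re := by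
    rcases h0.eq_or_lt with h1 | h1
    · rw [← h1, zero_mul] at hpos
      exact absurd hpos (lt_irrefl 0)
    · exact h1
  exact ⟨hre, pos_of_mul_pos_right hpos h0⟩

theorem robinDet_eq_mul (ζ α : ℂ) (s : ℝ) :
    robinDet ζ α (2 * s) = expComb 1 ζ α s * expComb (-1) ζ α s := by
  have k1 : Complex.exp (ζ * s) * Complex.exp (-(ζ * s)) = 1 := by
    rw [← Complex.exp_add, add_neg_cancel, Complex.exp_zero]
  have e1 : Complex.exp (ζ * (2 * s : ℝ)) = Complex.exp (ζ * s) ^ 2 := by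
    rw [sq, ← Complex.exp_add]; congr 1; push_cast; ring
  have e2 : Complex.exp (-(ζ * (2 * s : ℝ))) = Complex.exp (-(ζ * s)) ^ 2 := by
    rw [sq, ← Complex.exp_add]; congr 1; push_cast; ring
  rw [robinDet, expComb, expComb, e1, e2]
  push_cast
  ring

/-- Each of the two factors is strictly larger in modulus at `l / 2` than at `0`, hence nonzero. -/
theorem robinDet_ne_zero {ζ : ℂ} (hre : 0 < ζ.re) (him : 0 < ζ.im) (h : (ζ ^ 2).re = -1) {l : ℝ}
    (hl : 0 < l) : robinDet ζ Complex.I l ≠ 0 := by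
  have hs : |(0 : ℝ)| < l / 2 := by
    rw [abs_zero]
    linarith
  rw [show l = 2 * (l / 2) by ring, robinDet_eq_mul]
  refine mul_ne_zero ?_ ?_
  · exact norm_pos_iff.1 ((norm_nonneg _).trans_lt (norm_expComb_lt (by norm_num) hre him h hs))
  · exact norm_pos_iff.1 ((norm_nonneg _).trans_lt (norm_expComb_lt (by norm_num) hre him h hs))

theorem robinDet_real_mul {k : ℝ} (ζ α : ℂ) (l : ℝ) :
    robinDet (k * ζ) (k * α) l = k ^ 2 * robinDet ζ α (k * l) := by
  have e : (k : ℂ) * ζ * l = ζ * (k * l : ℝ) := by push_cast; ring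
  rw [robinDet, robinDet, e]
  ring

/-! ### The scaled family: independence of the wave number and contraction. -/

section Scaled

variable {σ₀ L₀ δ₀ k : ℝ}

/-- The squares agree, and positive real parts exclude the opposite sign. -/
theorem zeta_scaledParams (hσ₀ : 0 < σ₀) (hk : 0 < k) :
    zeta (scaledParams σ₀ L₀ δ₀ k) = k * zeta (scaledParams σ₀ L₀ δ₀ 1) := by
  have h1 := zeta_sq (scaledParams σ₀ L₀ δ₀ k)
  have h2 := zeta_sq (scaledParams σ₀ L₀ δ₀ 1)
  have p1 := (zeta_re_pos_and_im_pos (P := scaledParams σ₀ L₀ δ₀ k) hk (mul_pos hσ₀ hk)).1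
  have p2 := (zeta_re_pos_and_im_pos (P := scaledParams σ₀ L₀ δ₀ 1) one_pos
    (mul_pos hσ₀ one_pos)).1
  generalize zeta (scaledParams σ₀ L₀ δ₀ k) = z at *
  generalize zeta (scaledParams σ₀ L₀ δ₀ 1) = z₁ at *
  have h : z ^ 2 = (k * z₁) ^ 2 := by
    rw [mul_pow, h1, h2]
    simp only [scaledParams]
    push_cast
    ring
  rcases sq_eq_sq_iff_eq_or_eq_neg.1 h with h | h
  · exact h
  · rw [h, Complex.neg_re, Complex.re_ofReal_mul] at p1
    have := mul_pos hk p2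
    linarith

theorem zeta_scaledParams_one_sq_re : (zeta (scaledParams σ₀ L₀ δ₀ 1) ^ 2).re = -1 := by
  rw [zeta_sq]
  simp [scaledParams]

theorem zeta_scaledParams_one_pos (hσ₀ : 0 < σ₀) :
    0 < (zeta (scaledParams σ₀ L₀ δ₀ 1)).re ∧ 0 < (zeta (scaledParams σ₀ L₀ δ₀ 1)).im :=
  zeta_re_pos_and_im_pos (P := scaledParams σ₀ L₀ δ₀ 1) one_pos (mul_pos hσ₀ one_pos)

theorem zeta_scaledParams_ne_zero (hσ₀ : 0 < σ₀) (hk : 0 < k) :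
    zeta (scaledParams σ₀ L₀ δ₀ k) ≠ 0 := by
  intro h
  have := (zeta_re_pos_and_im_pos (P := scaledParams σ₀ L₀ δ₀ k) hk (mul_pos hσ₀ hk)).1
  rw [h, Complex.zero_re] at this
  exact lt_irrefl _ this

theorem robinDet_scaledParams_ne_zero (hσ₀ : 0 < σ₀) (hk : 0 < k) {l : ℝ} (hl : 0 < l) :
    robinDet (zeta (scaledParams σ₀ L₀ δ₀ k)) (scaledParams σ₀ L₀ δ₀ k).α l ≠ 0 := by
  have hα : (scaledParams σ₀ L₀ δ₀ k).α = k * Complex.I := mul_comm _ _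
  have hp := zeta_scaledParams_one_pos (L₀ := L₀) (δ₀ := δ₀) hσ₀
  rw [zeta_scaledParams hσ₀ hk, hα, robinDet_real_mul]
  refine mul_ne_zero (pow_ne_zero 2 (Complex.ofReal_ne_zero.2 hk.ne')) ?_
  exact robinDet_ne_zero hp.1 hp.2 zeta_scaledParams_one_sq_re (mul_pos hk hl)

theorem coeffD_scaledParams_ne_zero (hσ₀ : 0 < σ₀) (hL₀ : 0 < L₀) (hδ₀ : 0 < δ₀) (hk : 0 < k) :
    coeffD (scaledParams σ₀ L₀ δ₀ k) ≠ 0 := by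
  rw [coeffD_eq]
  refine robinDet_scaledParams_ne_zero hσ₀ hk ?_
  simp only [scaledParams]
  positivity

/-- Numerators and denominator are homogeneous of degree two in `(ζ, α)`, and every exponent is `ζ`
times a length. -/
theorem coeffs_scaledParams (hσ₀ : 0 < σ₀) (hk : 0 < k) :
    coeffA (scaledParams σ₀ L₀ δ₀ k) = coeffA (scaledParams σ₀ L₀ δ₀ 1) ∧
      coeffB (scaledParams σ₀ L₀ δ₀ k) = coeffB (scaledParams σ₀ L₀ δ₀ 1) := by
  have hk' : (k : ℂ) ≠ 0 := Complex.ofReal_ne_zero.2 hk.ne'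
  have hα : (scaledParams σ₀ L₀ δ₀ k).α = k * (scaledParams σ₀ L₀ δ₀ 1).α := by
    simp [scaledParams, mul_comm]
  have hL : ((scaledParams σ₀ L₀ δ₀ k).L : ℂ) = (k : ℂ)⁻¹ * (scaledParams σ₀ L₀ δ₀ 1).L := by
    simp [scaledParams, mul_comm]
  have hδ : ((scaledParams σ₀ L₀ δ₀ k).δ : ℂ) = (k : ℂ)⁻¹ * (scaledParams σ₀ L₀ δ₀ 1).δ := by
    simp [scaledParams, mul_comm]
  simp only [coeffA, coeffB, coeffD, zeta_scaledParams hσ₀ hk, hα, hL, hδ]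
  generalize zeta (scaledParams σ₀ L₀ δ₀ 1) = z
  generalize (scaledParams σ₀ L₀ δ₀ 1).α = α
  generalize ((scaledParams σ₀ L₀ δ₀ 1).L : ℂ) = L
  generalize ((scaledParams σ₀ L₀ δ₀ 1).δ : ℂ) = δ
  have e1 : k * z * (2 * ((k : ℂ)⁻¹ * δ) + (k : ℂ)⁻¹ * L) = z * (2 * δ + L) := by field_simp
  have e2 : 2 * (k * z) * ((k : ℂ)⁻¹ * δ) = 2 * z * δ := by field_simp
  have e3 : k * z * ((k : ℂ)⁻¹ * L) = z * L := by field_simp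
  have f1 : (k * z + k * α) ^ 2 = k ^ 2 * (z + α) ^ 2 := by ring
  have f2 : (k * z - k * α) ^ 2 = k ^ 2 * (z - α) ^ 2 := by ring
  have f3 : (k * z) ^ 2 - (k * α) ^ 2 = k ^ 2 * (z ^ 2 - α ^ 2) := by ring
  have hk2 : (k : ℂ) ^ 2 ≠ 0 := pow_ne_zero 2 hk'
  rw [e1, e2, e3, f1, f2, f3]
  simp only [mul_assoc, ← mul_sub, ← mul_neg]
  exact ⟨mul_div_mul_left _ _ hk2, mul_div_mul_left _ _ hk2⟩

/-- Here `ζ² - α² = i σ₀`, and `e^{ζ L}`, `e^{-ζ L}` differ in modulus. -/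
theorem coeffB_scaledParams_ne_zero (hσ₀ : 0 < σ₀) (hL₀ : 0 < L₀) (hδ₀ : 0 < δ₀) :
    coeffB (scaledParams σ₀ L₀ δ₀ 1) ≠ 0 := by
  have hz := (zeta_scaledParams_one_pos (L₀ := L₀) (δ₀ := δ₀) hσ₀).1
  rw [coeffB]
  refine div_ne_zero (neg_ne_zero.2 (mul_ne_zero ?_ (sub_ne_zero.2 fun h => ?_)))
    (coeffD_scaledParams_ne_zero hσ₀ hL₀ hδ₀ one_pos)
  · rw [zeta_sq]
    simp [scaledParams, hσ₀.ne']
  · have h1 := congrArg norm h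
    rw [Complex.norm_exp, Complex.norm_exp, Real.exp_eq_exp, Complex.neg_re,
      Complex.re_mul_ofReal] at h1
    have : 0 < (scaledParams σ₀ L₀ δ₀ 1).L := by simpa [scaledParams] using hL₀
    have := mul_pos hz this
    linarith

/-- The eigenvalues `a ± b` of the symbol at frequency zero as quotients. -/
theorem coeffA_sub_mul_coeffB {P : Params} (hD : coeffD P ≠ 0) {ε : ℝ} (hε : ε = 1 ∨ ε = -1) :
    coeffA P - ε * coeffB P =
      expComb ε (zeta P) P.α (P.δ - P.L / 2) / expComb ε (zeta P) P.α (P.δ + P.L / 2) := by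
  have hDe : coeffD P = expComb 1 (zeta P) P.α (P.δ + P.L / 2) *
      expComb (-1) (zeta P) P.α (P.δ + P.L / 2) := by
    rw [coeffD_eq, ← robinDet_eq_mul]
    congr 1
    ring
  have hne := mul_ne_zero_iff.1 (hDe ▸ hD)
  have e1 : zeta P * ((P.δ - P.L / 2 : ℝ) : ℂ) = zeta P * P.δ + -(zeta P * P.L / 2) := by
    push_cast; ring
  have e2 : zeta P * ((P.δ + P.L / 2 : ℝ) : ℂ) = zeta P * P.δ + zeta P * P.L / 2 := by
    push_cast; ring
  have e3 : 2 * zeta P * P.δ = zeta P * P.δ + zeta P * P.δ := by ring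
  have e4 : zeta P * P.L = zeta P * P.L / 2 + zeta P * P.L / 2 := by ring
  have k1 : Complex.exp (zeta P * P.L / 2) * Complex.exp (-(zeta P * P.L / 2)) = 1 := by
    rw [← Complex.exp_add, add_neg_cancel, Complex.exp_zero]
  have k2 : Complex.exp (zeta P * P.δ) * Complex.exp (-(zeta P * P.δ)) = 1 := by
    rw [← Complex.exp_add, add_neg_cancel, Complex.exp_zero]
  -- The numerator splits off the factor of `D` with sign `-ε`, which cancels.
  have hnum : (zeta P + P.α) ^ 2 * Complex.exp (2 * zeta P * P.δ)
        - (zeta P - P.α) ^ 2 * Complex.exp (-(2 * zeta P * P.δ)) -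
      ε * -((zeta P ^ 2 - P.α ^ 2) *
        (Complex.exp (zeta P * P.L) - Complex.exp (-(zeta P * P.L)))) =
      expComb ε (zeta P) P.α (P.δ - P.L / 2) * expComb (-ε) (zeta P) P.α (P.δ + P.L / 2) := by
    rw [e3, e4, expComb, expComb, e1, e2]
    simp only [neg_add, Complex.exp_add, neg_neg]
    generalize Complex.exp (zeta P * P.L / 2) = F at *
    generalize Complex.exp (-(zeta P * P.L / 2)) = F' at *
    generalize Complex.exp (zeta P * P.δ) = G at *
    generalize Complex.exp (-(zeta P * P.δ)) = G' at *
    have hε2 : (ε : ℂ) ^ 2 = 1 := by rcases hε with rfl | rfl <;> norm_num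
    push_cast
    linear_combination -((zeta P + P.α) ^ 2 * G ^ 2) * k1 +
      (zeta P - P.α) ^ 2 * G' ^ 2 * (ε ^ 2 * k1 + hε2) -
      ε * (zeta P ^ 2 - P.α ^ 2) * (F ^ 2 - F' ^ 2) * k2
  rw [coeffA, coeffB, mul_div_assoc', ← sub_div, hnum, hDe]
  rcases hε with rfl | rfl
  · rw [mul_div_mul_right _ _ hne.2]
  · rw [neg_neg, mul_comm (expComb 1 _ _ _), mul_div_mul_right _ _ hne.1]

theorem norm_coeffA_sub_mul_coeffB_lt_one (hσ₀ : 0 < σ₀) (hL₀ : 0 < L₀) (hδ₀ : 0 < δ₀) {ε : ℝ}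
    (hε : ε = 1 ∨ ε = -1) :
    ‖coeffA (scaledParams σ₀ L₀ δ₀ 1) - ε * coeffB (scaledParams σ₀ L₀ δ₀ 1)‖ < 1 := by
  have hα : (scaledParams σ₀ L₀ δ₀ 1).α = Complex.I := by simp [scaledParams]
  have hL : (scaledParams σ₀ L₀ δ₀ 1).L = L₀ := by simp [scaledParams]
  have hδ : (scaledParams σ₀ L₀ δ₀ 1).δ = δ₀ := by simp [scaledParams]
  have hz := zeta_scaledParams_one_pos (L₀ := L₀) (δ₀ := δ₀) hσ₀
  have hlt : |δ₀ - L₀ / 2| < δ₀ + L₀ / 2 := abs_lt.2 ⟨by linarith, by linarith⟩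
  have hε2 : ε ^ 2 = 1 := by rcases hε with rfl | rfl <;> norm_num
  rw [coeffA_sub_mul_coeffB (coeffD_scaledParams_ne_zero hσ₀ hL₀ hδ₀ one_pos) hε, hα, hL, hδ,
    norm_div]
  have h := norm_expComb_lt hε2 hz.1 hz.2 zeta_scaledParams_one_sq_re hlt
  rwa [div_lt_one ((norm_nonneg _).trans_lt h)]

theorem max_norm_coeffs_lt_one (hσ₀ : 0 < σ₀) (hL₀ : 0 < L₀) (hδ₀ : 0 < δ₀) :
    max ‖coeffA (scaledParams σ₀ L₀ δ₀ 1) + coeffB (scaledParams σ₀ L₀ δ₀ 1)‖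
      ‖coeffA (scaledParams σ₀ L₀ δ₀ 1) - coeffB (scaledParams σ₀ L₀ δ₀ 1)‖ < 1 := by
  refine max_lt ?_ ?_
  · simpa using norm_coeffA_sub_mul_coeffB_lt_one hσ₀ hL₀ hδ₀ (Or.inr rfl)
  · simpa using norm_coeffA_sub_mul_coeffB_lt_one hσ₀ hL₀ hδ₀ (Or.inl rfl)

theorem iterMatrix_scaledParams (hσ₀ : 0 < σ₀) (hk : 0 < k) (N : ℕ) :
    iterMatrix (scaledParams σ₀ L₀ δ₀ k) N = iterMatrix (scaledParams σ₀ L₀ δ₀ 1) N := by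
  rw [iterMatrix, iterMatrix, (coeffs_scaledParams hσ₀ hk).1, (coeffs_scaledParams hσ₀ hk).2]

theorem interfaceData_scaledParams_succ (hσ₀ : 0 < σ₀) (hL₀ : 0 < L₀) (hδ₀ : 0 < δ₀) (hk : 0 < k)
    {N : ℕ} {x₀ : ℝ} {g₁ g₂ : ℂ} {u : ℝ → ℂ} {w : ℕ → ℕ → ℝ → ℂ}
    (h : IsSchwarzRun (scaledParams σ₀ L₀ δ₀ k) N x₀ g₁ g₂ u w) (n : ℕ) :
    interfaceData (scaledParams σ₀ L₀ δ₀ k) N x₀ u (w (n + 1)) =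
      (iterMatrix (scaledParams σ₀ L₀ δ₀ k) N).mulVec
        (interfaceData (scaledParams σ₀ L₀ δ₀ k) N x₀ u (w n)) :=
  interfaceData_succ (zeta_scaledParams_ne_zero hσ₀ hk) (mul_pos hL₀ (inv_pos.2 hk))
    (mul_pos hδ₀ (inv_pos.2 hk)) (coeffD_scaledParams_ne_zero hσ₀ hL₀ hδ₀ hk) h n

theorem euclNorm_interfaceData_le (hσ₀ : 0 < σ₀) (hL₀ : 0 < L₀) (hδ₀ : 0 < δ₀) (hk : 0 < k)
    {N : ℕ} {x₀ : ℝ} {g₁ g₂ : ℂ} {u : ℝ → ℂ} {w : ℕ → ℕ → ℝ → ℂ}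
    (h : IsSchwarzRun (scaledParams σ₀ L₀ δ₀ k) N x₀ g₁ g₂ u w) (n : ℕ) :
    euclNorm (interfaceData (scaledParams σ₀ L₀ δ₀ k) N x₀ u (w n)) ≤
      max ‖coeffA (scaledParams σ₀ L₀ δ₀ 1) + coeffB (scaledParams σ₀ L₀ δ₀ 1)‖
        ‖coeffA (scaledParams σ₀ L₀ δ₀ 1) - coeffB (scaledParams σ₀ L₀ δ₀ 1)‖ ^ n *
      euclNorm (interfaceData (scaledParams σ₀ L₀ δ₀ k) N x₀ u (w 0)) := by
  induction n with
  | zero => simp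
  | succ n ih =>
    rw [interfaceData_scaledParams_succ hσ₀ hL₀ hδ₀ hk h, iterMatrix_scaledParams hσ₀ hk, pow_succ',
      mul_assoc]
    refine (euclNorm_blockToeplitz_mulVec_le _ _ _ _).trans ?_
    exact mul_le_mul_of_nonneg_left ih ((norm_nonneg _).trans (le_max_left _ _))

end Scaled

end Schwarz1D

/-! ### Assembly of the five claims. -/

theorem corollary3p5 (σ₀ L₀ δ₀ : ℝ) (hσ₀ : 0 < σ₀) (hL₀ : 0 < L₀) (hδ₀ : 0 < δ₀) :
    -- the boundary value problems of the method are well posed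
    (∀ k : ℝ, 0 < k → ∀ p q : ℝ, p < q → ∀ gl gr : ℂ,
      ∃ v : ℝ → ℂ, Schwarz1D.SolvesBVP (Schwarz1D.scaledParams σ₀ L₀ δ₀ k) p q gl gr v ∧
        ∀ v' : ℝ → ℂ, Schwarz1D.SolvesBVP (Schwarz1D.scaledParams σ₀ L₀ δ₀ k) p q gl gr v' →
          Set.EqOn v' v (Set.Icc p q)) ∧
    -- the Robin interface data of the errors are propagated by the iteration matrix
    (∀ k : ℝ, 0 < k → ∀ N : ℕ, 2 ≤ N → ∀ (x₀ : ℝ) (g₁ g₂ : ℂ) (u : ℝ → ℂ) (w : ℕ → ℕ → ℝ → ℂ),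
      Schwarz1D.IsSchwarzRun (Schwarz1D.scaledParams σ₀ L₀ δ₀ k) N x₀ g₁ g₂ u w → ∀ n : ℕ,
        Schwarz1D.interfaceData (Schwarz1D.scaledParams σ₀ L₀ δ₀ k) N x₀ u (w (n + 1)) =
          (Schwarz1D.iterMatrix (Schwarz1D.scaledParams σ₀ L₀ δ₀ k) N).mulVec
            (Schwarz1D.interfaceData (Schwarz1D.scaledParams σ₀ L₀ δ₀ k) N x₀ u (w n))) ∧
    -- the coefficients and the iteration matrix do not depend on the wave number
    (∀ k k' : ℝ, 0 < k → 0 < k' →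
      Schwarz1D.coeffA (Schwarz1D.scaledParams σ₀ L₀ δ₀ k) =
        Schwarz1D.coeffA (Schwarz1D.scaledParams σ₀ L₀ δ₀ k') ∧
      Schwarz1D.coeffB (Schwarz1D.scaledParams σ₀ L₀ δ₀ k) =
        Schwarz1D.coeffB (Schwarz1D.scaledParams σ₀ L₀ δ₀ k') ∧
      ∀ N : ℕ, Schwarz1D.iterMatrix (Schwarz1D.scaledParams σ₀ L₀ δ₀ k) N =
        Schwarz1D.iterMatrix (Schwarz1D.scaledParams σ₀ L₀ δ₀ k') N) ∧
    -- the convergence factor exists, is the same for all wave numbers, and is less than one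
    (∃ R : ℝ≥0∞, R < 1 ∧ ∀ k : ℝ, 0 < k →
      Tendsto
        (fun N : ℕ => spectralRadius ℂ (Schwarz1D.iterMatrix (Schwarz1D.scaledParams σ₀ L₀ δ₀ k) N))
        atTop (𝓝 R)) ∧
    -- the number of iterations for a given error reduction is ultimately independent of `N`
    -- and is independent of `k`
    (∀ ε : ℝ, 0 < ε → ∃ n₀ : ℕ, ∀ᶠ N : ℕ in atTop, ∀ k : ℝ, 0 < k →
      ∀ (x₀ : ℝ) (g₁ g₂ : ℂ) (u : ℝ → ℂ) (w : ℕ → ℕ → ℝ → ℂ),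
        Schwarz1D.IsSchwarzRun (Schwarz1D.scaledParams σ₀ L₀ δ₀ k) N x₀ g₁ g₂ u w →
          ∀ n : ℕ, n₀ ≤ n →
            Schwarz1D.euclNorm
                (Schwarz1D.interfaceData (Schwarz1D.scaledParams σ₀ L₀ δ₀ k) N x₀ u (w n)) ≤
              ε * Schwarz1D.euclNorm
                (Schwarz1D.interfaceData (Schwarz1D.scaledParams σ₀ L₀ δ₀ k) N x₀ u (w 0))) := by
  refine ⟨?_, ?_, ?_, ?_, ?_⟩
  · intro k hk p q hpq gl gr
    exact Schwarz1D.existsUnique_solvesBVP (Schwarz1D.zeta_scaledParams_ne_zero hσ₀ hk) hpq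
      (Schwarz1D.robinDet_scaledParams_ne_zero hσ₀ hk (sub_pos.2 hpq)) gl gr
  · intro k hk N _ x₀ g₁ g₂ u w h n
    exact Schwarz1D.interfaceData_scaledParams_succ hσ₀ hL₀ hδ₀ hk h n
  · intro k k' hk hk'
    have h := Schwarz1D.coeffs_scaledParams (L₀ := L₀) (δ₀ := δ₀) hσ₀ hk
    have h' := Schwarz1D.coeffs_scaledParams (L₀ := L₀) (δ₀ := δ₀) hσ₀ hk'
    refine ⟨h.1.trans h'.1.symm, h.2.trans h'.2.symm, fun N => ?_⟩
    rw [Schwarz1D.iterMatrix_scaledParams hσ₀ hk, Schwarz1D.iterMatrix_scaledParams hσ₀ hk']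
  · refine ⟨ENNReal.ofReal _,
      ENNReal.ofReal_lt_one.2 (Schwarz1D.max_norm_coeffs_lt_one hσ₀ hL₀ hδ₀), fun k hk => ?_⟩
    simp only [Schwarz1D.iterMatrix_scaledParams hσ₀ hk]
    -- `N` subdomains give `N - 1` blocks, whence the shift of the index.
    exact (Schwarz1D.tendsto_spectralRadius_blockToeplitz _ _
      (Schwarz1D.coeffB_scaledParams_ne_zero hσ₀ hL₀ hδ₀)).comp (tendsto_sub_atTop_nat 1)
  · intro ε hε
    have hR := Schwarz1D.max_norm_coeffs_lt_one hσ₀ hL₀ hδ₀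
    obtain ⟨n₀, hn₀⟩ := exists_pow_lt_of_lt_one hε hR
    -- The contraction bound is uniform in the matrix size, so the chosen `n₀` serves every `N`.
    refine ⟨n₀, Eventually.of_forall fun N k hk x₀ g₁ g₂ u w h n hn => ?_⟩
    refine (Schwarz1D.euclNorm_interfaceData_le hσ₀ hL₀ hδ₀ hk h n).trans ?_
    refine mul_le_mul_of_nonneg_right ?_ (Schwarz1D.euclNorm_nonneg _)
    exact (pow_le_pow_of_le_one ((norm_nonneg _).trans (le_max_left _ _)) hR.le hn).trans hn₀.le
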